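/- Let $\mathsf{RCA}_0$ be the usual subsystem of second-order arithmetic (basic axioms, $\Sigma^0_1$ induction, $\Delta^0_1$ comprehension). Write $k$ for the set $\{0,\dots,k-1\}$ and $[X]^n$ for the set of $n$-element subsets of $X\subseteq\mathbb N$, where $0\in\mathbb N$. The following are statements of second-order arithmetic. - For $n\ge 1$, $\mathbb Z\text{-}\mathsf{RT}^n$ says: for every $k$ and every colouring $c:[\mathbb N]^n\to k$ that is $\mathbb Z$-invariant, i.e. $c(\{x_1,\dots,x_n\})=c(\{x_1+z,\dots,x_n+z\})$ for all $\{x_1,\dots,x_n\}\in[\mathbb N]^n$ and $z\in\mathbb N$, there is an infinite set $X\subseteq\mathbb N$ such that $c$ is constant on $[X]^n$. - For $d\ge 1$, $\mathsf{AHT}^d$ says: for every $k$ and every $c:\mathbb N^d\to k$ there is an infinite set $Y\subseteq\mathbb N$ with increasing enumeration $\langle y_n\mid n\in\mathbb N\rangle$ such that $c$ is constant on the set of all tuples $$\left(\sum_{i=k_0}^{k_1}y_i,\ \sum_{i=k_1+1}^{k_2}y_i,\ \dots,\ \sum_{i=k_{d-1}+1}^{k_d}y_i\right),\qquad k_0\le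 k_1<k_2<\dots<k_d.$$ - $\mathsf{AHT}$ says: for every $k$ and every $c:\mathbb N\to k$ there is an infinite set $Y\subseteq\mathbb N$ with increasing enumeration $\langle y_n\mid n\in\mathbb N\rangle$ such that $c$ is constant on $\{y_n+y_{n+1}+\dots+y_{n+l}\mid n,l\in\mathbb N\}$. Then, for each (standard) natural number $d\ge 1$, $\mathsf{RCA}_0\vdash\mathbb Z\text{-}\mathsf{RT}^{d+1}\leftrightarrow\mathsf{AHT}^d$. In particular, $\mathsf{RCA}_0\vdash\mathsf{AHT}\leftrightarrow\mathbb Z\text{-}\mathsf{RT}^2$. -/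

import Mathlib

namespace SOA

/-! ## The language of second-order arithmetic -/

/-- Number terms of the two-sorted language with `0, 1, +, ·, =, <, ∈`. -/
inductive Tm : Type
  | var (i : ℕ) : Tm
  | zero : Tm
  | one : Tm
  | add (s t : Tm) : Tm
  | mul (s t : Tm) : Tm

/-- Formulas, up to renaming of bound variables (de Bruijn indices). Number variables and set
variables are indexed separately: `all` binds number variable `0` and `allSet` binds set
variable `0`, the variable `i + 1` below the quantifier being the variable `i` outside of it. -/
inductive Fm : Type
  | eq (s t : Tm) : Fm
  | lt (s t : Tm) : Fm
  | mem (t : Tm) (X : ℕ) : Fm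
  | fls : Fm
  | imp (φ ψ : Fm) : Fm
  | all (φ : Fm) : Fm
  | allSet (φ : Fm) : Fm

/-- Simultaneous substitution of terms for number variables. -/
def Tm.subst (σ : ℕ → Tm) : Tm → Tm
  | .var i => σ i
  | .zero => .zero
  | .one => .one
  | .add s t => .add (s.subst σ) (t.subst σ)
  | .mul s t => .mul (s.subst σ) (t.subst σ)

def Tm.shift (t : Tm) : Tm := t.subst fun i => .var (i + 1)

/-- `consVar a f` is the sequence `a, f 0, f 1, …`. -/
def consVar {α : Type} (a : α) (f : ℕ → α) : ℕ → α
  | 0 => a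
  | i + 1 => f i

/-- Capture-avoiding simultaneous substitution: terms `σ` for the free number variables and set
variables `ρ` for the free set variables. -/
def Fm.subst : (ℕ → Tm) → (ℕ → ℕ) → Fm → Fm
  | σ, _, .eq s t => .eq (s.subst σ) (t.subst σ)
  | σ, _, .lt s t => .lt (s.subst σ) (t.subst σ)
  | σ, ρ, .mem t X => .mem (t.subst σ) (ρ X)
  | _, _, .fls => .fls
  | σ, ρ, .imp φ ψ => .imp (φ.subst σ ρ) (ψ.subst σ ρ)
  | σ, ρ, .all φ => .all (φ.subst (consVar (.var 0) fun i => (σ i).shift) ρ)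
  | σ, ρ, .allSet φ => .allSet (φ.subst σ (consVar 0 fun X => ρ X + 1))

/-- Make room for a new number variable `0`. -/
def Fm.shift (φ : Fm) : Fm := φ.subst (fun i => .var (i + 1)) id

/-- Make room for a new set variable `0`. -/
def Fm.shiftSet (φ : Fm) : Fm := φ.subst .var (· + 1)

/-- `φ(t)`, for a formula `φ` below a number quantifier. -/
def Fm.inst (φ : Fm) (t : Tm) : Fm := φ.subst (consVar t .var) id

/-- `φ(X)`, for a formula `φ` below a set quantifier. -/
def Fm.instSet (φ : Fm) (X : ℕ) : Fm := φ.subst .var (consVar X id)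

def Fm.neg (φ : Fm) : Fm := .imp φ .fls
def Fm.tru : Fm := Fm.neg .fls
def Fm.and (φ ψ : Fm) : Fm := .neg (.imp φ (.neg ψ))
def Fm.or (φ ψ : Fm) : Fm := .imp (.neg φ) ψ
def Fm.iff (φ ψ : Fm) : Fm := .and (.imp φ ψ) (.imp ψ φ)
def Fm.ex (φ : Fm) : Fm := .neg (.all (.neg φ))
def Fm.exSet (φ : Fm) : Fm := .neg (.allSet (.neg φ))

infixr:55 " ⋏ " => Fm.and
infixr:54 " ⋎ " => Fm.or
infixr:53 " ➝ " => Fm.imp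
infix:52 " ⭤ " => Fm.iff

/-! ## Classical two-sorted first-order provability -/

/-- `Derives T Γ φ`: natural-deduction derivability of `φ` from the axioms `T` and the finitely
many hypotheses `Γ`. Free variables of axioms are read universally: a generalization must
respect the hypotheses in `Γ` only. -/
inductive Derives (T : Set Fm) : List Fm → Fm → Prop
  | ax {Γ : List Fm} {φ : Fm} : φ ∈ T → Derives T Γ φ
  | hyp {Γ : List Fm} {φ : Fm} : φ ∈ Γ → Derives T Γ φ
  | impI {Γ : List Fm} {φ ψ : Fm} : Derives T (φ :: Γ) ψ → Derives T Γ (φ ➝ ψ)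
  | impE {Γ : List Fm} {φ ψ : Fm} : Derives T Γ (φ ➝ ψ) → Derives T Γ φ → Derives T Γ ψ
  | raa {Γ : List Fm} {φ : Fm} : Derives T (φ.neg :: Γ) .fls → Derives T Γ φ
  | allI {Γ : List Fm} {φ : Fm} : Derives T (Γ.map Fm.shift) φ → Derives T Γ (.all φ)
  | allE {Γ : List Fm} {φ : Fm} (t : Tm) : Derives T Γ (.all φ) → Derives T Γ (φ.inst t)
  | allSetI {Γ : List Fm} {φ : Fm} :
      Derives T (Γ.map Fm.shiftSet) φ → Derives T Γ (.allSet φ)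
  | allSetE {Γ : List Fm} {φ : Fm} (X : ℕ) :
      Derives T Γ (.allSet φ) → Derives T Γ (φ.instSet X)
  | eqI {Γ : List Fm} (t : Tm) : Derives T Γ (.eq t t)
  | eqE {Γ : List Fm} {s t : Tm} (φ : Fm) :
      Derives T Γ (.eq s t) → Derives T Γ (φ.inst s) → Derives T Γ (φ.inst t)

/-- `T ⊢ φ`. -/
def Proves (T : Set Fm) (φ : Fm) : Prop := Derives T [] φ

/-! ## The theory RCA₀ -/

/-- Bounded-quantifier (`Σ⁰₀`) formulas: every quantifier is of the form `∀ n < t` or `∃ n < t`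
with a term `t` that does not contain `n`. -/
inductive Fm.Bounded : Fm → Prop
  | eq (s t : Tm) : Bounded (.eq s t)
  | lt (s t : Tm) : Bounded (.lt s t)
  | mem (t : Tm) (X : ℕ) : Bounded (.mem t X)
  | fls : Bounded .fls
  | imp {φ ψ : Fm} : Bounded φ → Bounded ψ → Bounded (φ ➝ ψ)
  | ball {φ : Fm} (t : Tm) : Bounded φ → Bounded (.all (.lt (.var 0) t.shift ➝ φ))
  | bex {φ : Fm} (t : Tm) : Bounded φ → Bounded (.ex (.lt (.var 0) t.shift ⋏ φ))

/-- `Σ⁰₁` formulas `∃ n θ`, with `θ` bounded. -/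
def Fm.IsSigma1 (φ : Fm) : Prop := ∃ θ : Fm, θ.Bounded ∧ φ = .ex θ

/-- `Π⁰₁` formulas `∀ n θ`, with `θ` bounded. -/
def Fm.IsPi1 (φ : Fm) : Prop := ∃ θ : Fm, θ.Bounded ∧ φ = .all θ

/-- The basic axioms, with free variables `m = var 0` and `n = var 1`. -/
inductive BasicAxiom : Fm → Prop
  | succ_ne_zero : BasicAxiom (Fm.neg (.eq (.add (.var 0) .one) .zero))
  | succ_inj : BasicAxiom
      (.eq (.add (.var 0) .one) (.add (.var 1) .one) ➝ .eq (.var 0) (.var 1))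
  | add_zero : BasicAxiom (.eq (.add (.var 0) .zero) (.var 0))
  | add_succ : BasicAxiom
      (.eq (.add (.var 0) (.add (.var 1) .one)) (.add (.add (.var 0) (.var 1)) .one))
  | mul_zero : BasicAxiom (.eq (.mul (.var 0) .zero) .zero)
  | mul_succ : BasicAxiom
      (.eq (.mul (.var 0) (.add (.var 1) .one)) (.add (.mul (.var 0) (.var 1)) (.var 0)))
  | not_lt_zero : BasicAxiom (Fm.neg (.lt (.var 0) .zero))
  | lt_succ : BasicAxiom
      (.lt (.var 0) (.add (.var 1) .one) ⭤ (.lt (.var 0) (.var 1) ⋎ .eq (.var 0) (.var 1)))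

/-- `φ(0) ∧ ∀ n (φ(n) → φ(n + 1)) → ∀ n φ(n)`; the variable `n` is `var 0` in `φ`. -/
def inductionAxiom (φ : Fm) : Fm :=
  (φ.inst .zero ⋏
    .all (φ ➝ φ.subst (consVar (.add (.var 0) .one) fun i => .var (i + 1)) id)) ➝ .all φ

/-- `∀ n (φ(n) ↔ ψ(n)) → ∃ X ∀ n (n ∈ X ↔ φ(n))`, with `X` not free in `φ`; the variable `n` is
`var 0` in `φ` and `ψ`. -/
def comprehensionAxiom (φ ψ : Fm) : Fm :=
  .all (φ ⭤ ψ) ➝ .exSet (.all (.mem (.var 0) 0 ⭤ φ.shiftSet))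

/-- `RCA₀`: the basic axioms, `Σ⁰₁` induction and `Δ⁰₁` comprehension, where `φ` and `ψ` may
contain further free number and set variables as parameters. -/
inductive RCA0 : Set Fm
  | basic {φ : Fm} : BasicAxiom φ → RCA0 φ
  | induction {φ : Fm} : φ.IsSigma1 → RCA0 (inductionAxiom φ)
  | comprehension {φ ψ : Fm} : φ.IsSigma1 → ψ.IsPi1 → RCA0 (comprehensionAxiom φ ψ)

/-! ## Quantification over named variables -/

/-- `∀ x φ`, for the free number variable `x` of `φ`: it becomes the bound index `0`. -/
def All (x : ℕ) (φ : Fm) : Fm :=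
  .all (φ.subst (fun i => if i = x then .var 0 else .var (i + 1)) id)

/-- `∃ x φ`. -/
def Ex (x : ℕ) (φ : Fm) : Fm := .neg (All x φ.neg)

/-- `∀ X φ`, for the free set variable `X` of `φ`. -/
def AllSet (X : ℕ) (φ : Fm) : Fm :=
  .allSet (φ.subst .var fun i => if i = X then 0 else i + 1)

/-- `∃ X φ`. -/
def ExSet (X : ℕ) (φ : Fm) : Fm := .neg (AllSet X φ.neg)

/-- `∀ x₁ … ∀ xₙ φ`. -/
def AllList (xs : List ℕ) (φ : Fm) : Fm := xs.foldr All φ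

/-- `∃ x₁ … ∃ xₙ φ`. -/
def ExList (xs : List ℕ) (φ : Fm) : Fm := xs.foldr Ex φ

/-- Finite conjunction. -/
def conj (φs : List Fm) : Fm := φs.foldr Fm.and Fm.tru

/-! Names of number variables; the names `x i` and `y i` are used for tuples. -/

abbrev k : ℕ := 0
abbrev c : ℕ := 1
abbrev j : ℕ := 2
abbrev j' : ℕ := 3
abbrev z : ℕ := 4
abbrev a : ℕ := 5
abbrev b : ℕ := 6
abbrev u : ℕ := 7
abbrev w : ℕ := 8
abbrev x (i : ℕ) : ℕ := 10 + 2 * i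
abbrev y (i : ℕ) : ℕ := 11 + 2 * i

/-! Names of set variables. -/

abbrev C : ℕ := 0
abbrev X : ℕ := 1
abbrev E : ℕ := 2
abbrev S : ℕ := 3

/-! ## Coding of tuples and functions -/

/-- `s ≤ t`. -/
def le (s t : Tm) : Fm := .lt s t ⋎ .eq s t

/-- The pairing function `(s, t) = (s + t)² + s`. -/
def pair (s t : Tm) : Tm := .add (.mul (.add s t) (.add s t)) s

/-- Codes of tuples, `(t₁, (t₂, (…, tₙ)))`. -/
def tuple : List Tm → Tm
  | [] => .zero
  | [t] => t
  | t :: s :: ts => pair t (tuple (s :: ts))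

/-- `F(t₁, …, tₙ) = v`, for a function `F` represented by its graph. -/
def app (F : ℕ) (ts : List Tm) (v : Tm) : Fm := .mem (pair (tuple ts) v) F

/-- `F` is a function with domain `{(x₁, …, xₙ) : D}` and values in `{j : R}`: it is a subset of
the product, and each tuple of the domain has exactly one value. -/
def isFunction (F : ℕ) (xs : List ℕ) (D R : Fm) : Fm :=
  All z (.mem (.var z) F ➝
    ExList xs (Ex j (D ⋏ R ⋏ .eq (.var z) (pair (tuple (xs.map .var)) (.var j))))) ⋏
  AllList xs (D ➝
    Ex j (R ⋏ app F (xs.map .var) (.var j) ⋏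
      All j' (app F (xs.map .var) (.var j') ➝ .eq (.var j') (.var j))))

/-- `x₁ < x₂ < ⋯ < xₙ`. -/
def increasing : List ℕ → Fm
  | [] => .tru
  | [_] => .tru
  | s :: t :: l => .lt (.var s) (.var t) ⋏ increasing (t :: l)

/-- The set `F` is infinite (unbounded). -/
def infinite (F : ℕ) : Fm := All a (Ex b (.lt (.var a) (.var b) ⋏ .mem (.var b) F))

/-! ## The `ℤ`-invariant Ramsey theorem -/

/-- The names `x₀, …, xₙ₋₁`. -/
def xs (n : ℕ) : List ℕ := (List.range n).map x

/-- `C` is a colouring `[ℕ]ⁿ → k`; an `n`-subset is given by its increasing enumeration. -/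
def isColouringOfSubsets (n : ℕ) : Fm :=
  isFunction C (xs n) (increasing (xs n)) (.lt (.var j) (.var k))

/-- `C(x₁, …, xₙ) = C(x₁ + z, …, xₙ + z)` for every `n`-subset and every `z`. -/
def isInvariant (n : ℕ) : Fm :=
  AllList (xs n) (All z (All j (increasing (xs n) ➝
    (app C ((xs n).map .var) (.var j) ⭤
      app C ((xs n).map fun i => .add (.var i) (.var z)) (.var j)))))

/-- `[X]ⁿ` is `C`-monochromatic. -/
def isHomogeneous (n : ℕ) : Fm :=
  Ex c (AllList (xs n) (increasing (xs n) ⋏ conj ((xs n).map fun i => .mem (.var i) X) ➝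
    app C ((xs n).map .var) (.var c)))

/-- `ℤ-RTⁿ`. -/
def ZRT (n : ℕ) : Fm :=
  AllSet C (All k (isColouringOfSubsets n ⋏ isInvariant n ➝
    ExSet X (infinite X ⋏ isHomogeneous n)))

/-! ## The adjacent Hindman theorem -/

/-- The names `y₀, …, y_{d-1}`. -/
def ys (d : ℕ) : List ℕ := (List.range d).map y

/-- `C` is a colouring `ℕᵈ → k`. -/
def isColouringOfTuples (d : ℕ) : Fm :=
  isFunction C (ys d) .tru (.lt (.var j) (.var k))

/-- `E : ℕ → ℕ` is the increasing enumeration of the set `X`. -/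
def isEnumeration : Fm :=
  isFunction E [a] .tru .tru ⋏
  All a (All b (All u (All w
    (.lt (.var a) (.var b) ⋏ app E [.var a] (.var u) ⋏ app E [.var b] (.var w) ➝
      .lt (.var u) (.var w))))) ⋏
  All u (.mem (.var u) X ⭤ Ex a (app E [.var a] (.var u)))

/-- `S(a, b) = E(a) + E(a + 1) + ⋯ + E(b)` for all `a ≤ b`. -/
def isAdjacentSums : Fm :=
  isFunction S [a, b] (le (.var a) (.var b)) .tru ⋏
  All a (All u (app S [.var a, .var a] (.var u) ⭤ app E [.var a] (.var u))) ⋏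
  All a (All b (All u (All w
    (le (.var a) (.var b) ⋏ app S [.var a, .var b] (.var u) ⋏
        app E [.add (.var b) .one] (.var w) ➝
      app S [.var a, .add (.var b) .one] (.add (.var u) (.var w))))))

/-- The index at which the `i`-th of the adjacent sums starts, in terms of the indices
`x₀ ≤ x₁ < x₂ < ⋯`: it is `x₀` for `i = 0` and `xᵢ + 1` for `i > 0`. -/
def start : ℕ → Tm
  | 0 => .var (x 0)
  | i + 1 => .add (.var (x (i + 1))) .one

/-- With the indices `x₀ ≤ x₁ < ⋯ < x_d`, the tuple `(y₀, …, y_{d-1})` is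
`(∑_{n=x₀}^{x₁} E(n), ∑_{n=x₁+1}^{x₂} E(n), …, ∑_{n=x_{d-1}+1}^{x_d} E(n))`. -/
def isAdjacentTuple (d : ℕ) : Fm :=
  le (.var (x 0)) (.var (x 1)) ⋏ increasing (xs (d + 1)).tail ⋏
  conj ((List.range d).map fun i => app S [start i, .var (x (i + 1))] (.var (y i)))

/-- `AHTᵈ`, for `d ≥ 1`. -/
def AHTd (d : ℕ) : Fm :=
  AllSet C (All k (isColouringOfTuples d ➝
    ExSet X (infinite X ⋏ ExSet E (isEnumeration ⋏ ExSet S (isAdjacentSums ⋏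
      Ex c (AllList (xs (d + 1)) (AllList (ys d) (isAdjacentTuple d ➝
        app C ((ys d).map .var) (.var c)))))))))

/-- `AHT`: the adjacent sums are `E(a) + E(a + 1) + ⋯ + E(a + b)`. -/
def AHT : Fm :=
  AllSet C (All k (isFunction C [u] .tru (.lt (.var j) (.var k)) ➝
    ExSet X (infinite X ⋏ ExSet E (isEnumeration ⋏ ExSet S (isAdjacentSums ⋏
      Ex c (All a (All b (All u
        (app S [.var a, .add (.var a) (.var b)] (.var u) ➝ app C [.var u] (.var c))))))))))

end SOA

/-! By the completeness theorem it suffices to prove the equivalence in every model of `RCA₀`, in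
the language of arithmetic and bounded definability.

A colouring `c` of `d`-tuples induces the invariant colouring
`{x₀ < ⋯ < x_d} ↦ c (x₁ - x₀, …, x_d - x_{d-1})`. If it is constant on the subsets of a sequence
`x` that grows fast enough for `yₙ = xₙ₊₁ - xₙ` to be increasing, then `c` is constant on the tuples
of adjacent sums of `y`, because the sum `y_m + ⋯ + y_n` is the difference `xₙ₊₁ - x_m`. Conversely,
an invariant colouring of `(d + 1)`-element subsets depends only on the successive differences.
If `y` is a solution for the colouring of these `d`-tuples of differences, then the set of all
`y₀ + ⋯ + yₙ` is homogeneous. -/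

namespace SOA

/-! ## Substitution -/

theorem Tm.subst_var (t : Tm) : t.subst .var = t := by
  induction t <;> simp_all [Tm.subst]

theorem Tm.subst_subst (σ τ : ℕ → Tm) (t : Tm) :
    (t.subst σ).subst τ = t.subst fun i => (σ i).subst τ := by
  induction t <;> simp_all [Tm.subst]

theorem Tm.shift_subst (t s : Tm) (σ : ℕ → Tm) : t.shift.subst (consVar s σ) = t.subst σ := by
  simp [Tm.shift, Tm.subst_subst, Tm.subst, consVar]

theorem consVar_zero_succ {α : Type} (f : ℕ → α) : consVar (f 0) (fun i => f (i + 1)) = f := by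
  funext i; cases i <;> rfl

theorem Fm.subst_var (φ : Fm) : φ.subst .var id = φ := by
  have lift_var : (consVar (.var 0) fun i => (Tm.var i).shift) = Tm.var := by
    funext i; cases i <;> rfl
  have lift_id : (consVar 0 fun X => id X + 1) = (id : ℕ → ℕ) := by
    funext i; cases i <;> rfl
  induction φ <;> simp_all [Fm.subst, Tm.subst_var]

theorem Fm.subst_subst (φ : Fm) (σ τ : ℕ → Tm) (ρ ν : ℕ → ℕ) :
    (φ.subst σ ρ).subst τ ν = φ.subst (fun i => (σ i).subst τ) (fun i => ν (ρ i)) := by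
  induction φ generalizing σ τ ρ ν with
  | eq s t | lt s t | mem s t => simp [Fm.subst, Tm.subst_subst]
  | fls => rfl
  | imp φ ψ ihφ ihψ => simp [Fm.subst, ihφ, ihψ]
  | all φ ih =>
    simp only [Fm.subst, ih]
    congr 2
    funext i
    cases i with
    | zero => rfl
    | succ i =>
      simp only [consVar, Tm.shift_subst]
      simp only [Tm.shift, Tm.subst_subst]
  | allSet φ ih =>
    simp only [Fm.subst, ih]
    congr 2
    funext i
    cases i <;> rfl

theorem Fm.lift_subst_inst (φ : Fm) (t : Tm) (σ : ℕ → Tm) (ρ : ℕ → ℕ) :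
    (φ.subst (consVar (.var 0) fun i => (σ i).shift) ρ).inst t = φ.subst (consVar t σ) ρ := by
  simp only [Fm.inst, Fm.subst_subst]
  congr 1
  funext i
  cases i with
  | zero => rfl
  | succ i => simp [consVar, Tm.shift_subst, Tm.subst_var]

theorem Fm.lift_subst_instSet (φ : Fm) (Y : ℕ) (σ : ℕ → Tm) (ρ : ℕ → ℕ) :
    (φ.subst σ (consVar 0 fun i => ρ i + 1)).instSet Y = φ.subst σ (consVar Y ρ) := by
  simp only [Fm.instSet, Fm.subst_subst, Tm.subst_var]
  congr 1
  funext i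
  cases i <;> rfl

theorem Fm.inst_subst (φ : Fm) (t : Tm) (σ : ℕ → Tm) (ρ : ℕ → ℕ) :
    (φ.inst t).subst σ ρ =
      (φ.subst (consVar (.var 0) fun i => (σ i).shift) ρ).inst (t.subst σ) := by
  rw [Fm.lift_subst_inst, Fm.inst, Fm.subst_subst]
  congr 1
  funext i
  cases i <;> rfl

theorem Fm.instSet_subst (φ : Fm) (Y : ℕ) (σ : ℕ → Tm) (ρ : ℕ → ℕ) :
    (φ.instSet Y).subst σ ρ =
      (φ.subst σ (consVar 0 fun i => ρ i + 1)).instSet (ρ Y) := by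
  rw [Fm.lift_subst_instSet, Fm.instSet, Fm.subst_subst]
  congr 1
  funext i
  cases i <;> rfl

theorem Fm.shift_subst (φ : Fm) (σ : ℕ → Tm) (ρ : ℕ → ℕ) :
    φ.shift.subst (consVar (.var 0) fun i => (σ i).shift) ρ = (φ.subst σ ρ).shift := by
  simp only [Fm.shift, Fm.subst_subst]
  rfl

theorem Fm.shiftSet_subst (φ : Fm) (σ : ℕ → Tm) (ρ : ℕ → ℕ) :
    φ.shiftSet.subst σ (consVar 0 fun i => ρ i + 1) = (φ.subst σ ρ).shiftSet := by
  simp only [Fm.shiftSet, Fm.subst_subst, Tm.subst_var]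
  rfl

/-- A strict upper bound for the variables of a term. -/
def Tm.varBound : Tm → ℕ
  | .var i => i + 1
  | .zero | .one => 0
  | .add s t | .mul s t => max s.varBound t.varBound

/-- A strict upper bound for the indices of all variables of a formula, of both sorts. Below a
quantifier the indices are not lowered, so that the bound need not be sharp. -/
def Fm.varBound : Fm → ℕ
  | .eq s t | .lt s t => max s.varBound t.varBound
  | .mem t Y => max t.varBound (Y + 1)
  | .fls => 0
  | .imp φ ψ => max φ.varBound ψ.varBound
  | .all φ | .allSet φ => φ.varBound

theorem Tm.subst_congr {σ τ : ℕ → Tm} (t : Tm) (h : ∀ i < t.varBound, σ i = τ i) :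
    t.subst σ = t.subst τ := by
  induction t <;> simp_all [Tm.subst, Tm.varBound]

theorem consVar_congr {α : Type} {f g : ℕ → α} {n : ℕ} (a : α) (h : ∀ i < n, f i = g i) :
    ∀ i < n, consVar a f i = consVar a g i
  | 0, _ => rfl
  | i + 1, hi => h i (by omega)

theorem Fm.subst_congr {σ τ : ℕ → Tm} {ρ ν : ℕ → ℕ} (φ : Fm)
    (hσ : ∀ i < φ.varBound, σ i = τ i) (hρ : ∀ i < φ.varBound, ρ i = ν i) :
    φ.subst σ ρ = φ.subst τ ν := by
  induction φ generalizing σ τ ρ ν with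
  | eq s t | lt s t =>
    simp only [Fm.varBound, lt_max_iff] at hσ
    simp only [Fm.subst]
    rw [s.subst_congr fun i hi => hσ i (.inl hi), t.subst_congr fun i hi => hσ i (.inr hi)]
  | mem t Y =>
    simp only [Fm.varBound, lt_max_iff] at hσ hρ
    simp only [Fm.subst]
    rw [t.subst_congr fun i hi => hσ i (.inl hi), hρ Y (.inr Y.lt_succ_self)]
  | fls => rfl
  | imp φ ψ ihφ ihψ =>
    simp only [Fm.varBound, lt_max_iff] at hσ hρ
    simp only [Fm.subst]
    rw [ihφ (fun i hi => hσ i (.inl hi)) fun i hi => hρ i (.inl hi),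
      ihψ (fun i hi => hσ i (.inr hi)) fun i hi => hρ i (.inr hi)]
  | all φ ih =>
    exact congrArg _ (ih (consVar_congr _ fun i hi => congrArg Tm.shift (hσ i hi)) hρ)
  | allSet φ ih =>
    exact congrArg _ (ih hσ (consVar_congr _ fun i hi => congrArg (· + 1) (hρ i hi)))

theorem exists_varBound_le (Γ : List Fm) : ∃ m, ∀ ψ ∈ Γ, ψ.varBound ≤ m := by
  obtain ⟨m, hm⟩ := (Γ.finite_toSet.image Fm.varBound).bddAbove
  exact ⟨m, fun ψ hψ => hm ⟨ψ, hψ, rfl⟩⟩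

/-! ## Derivations -/

section Derivations

variable {T : Set Fm} {Γ Δ : List Fm} {φ : Fm}

theorem Derives.weaken (h : Derives T Γ φ) (hs : Γ ⊆ Δ) : Derives T Δ φ := by
  induction h generalizing Δ with
  | ax h => exact .ax h
  | hyp h => exact .hyp (hs h)
  | impI _ ih => exact .impI (ih (List.cons_subset_cons _ hs))
  | impE _ _ ih₁ ih₂ => exact .impE (ih₁ hs) (ih₂ hs)
  | raa _ ih => exact .raa (ih (List.cons_subset_cons _ hs))
  | allI _ ih => exact .allI (ih (List.map_subset _ hs))
  | allE t _ ih => exact .allE t (ih hs)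
  | allSetI _ ih => exact .allSetI (ih (List.map_subset _ hs))
  | allSetE t _ ih => exact .allSetE t (ih hs)
  | eqI t => exact .eqI t
  | eqE φ _ _ ih₁ ih₂ => exact .eqE φ (ih₁ hs) (ih₂ hs)

theorem Derives.fls_elim (h : Derives T Γ .fls) : Derives T Γ φ :=
  .raa (h.weaken (List.subset_cons_self _ _))

-- Generalizing the first `n` variables and then instantiating them realizes any substitution
-- that undoes these generalizations on the remaining variables.
theorem Derives.subst_of_eventually_var (h : Derives T [] φ) (n : ℕ) {σ : ℕ → Tm}
    (hσ : ∀ i, σ (i + n) = .var i) : Derives T [] (φ.subst σ id) := by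
  induction n generalizing φ σ with
  | zero => rwa [show σ = .var from funext hσ, Fm.subst_var]
  | succ n ih =>
    have := (ih (.allI h) (σ := fun i => σ (i + 1)) hσ).allE (σ 0)
    rwa [Fm.lift_subst_inst, consVar_zero_succ] at this

theorem Derives.substSet_of_eventually_id (h : Derives T [] φ) (n : ℕ) {ρ : ℕ → ℕ}
    (hρ : ∀ i, ρ (i + n) = i) : Derives T [] (φ.subst .var ρ) := by
  induction n generalizing φ ρ with
  | zero => rwa [show ρ = id from funext hρ, Fm.subst_var]
  | succ n ih =>
    have := (ih (.allSetI h) (ρ := fun i => ρ (i + 1)) hρ).allSetE (ρ 0)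
    rwa [Fm.lift_subst_instSet, consVar_zero_succ] at this

theorem Derives.subst_nil (h : Derives T [] φ) (σ : ℕ → Tm) (ρ : ℕ → ℕ) :
    Derives T [] (φ.subst σ ρ) := by
  have hset : Derives T [] (φ.subst .var ρ) := by
    have := h.substSet_of_eventually_id φ.varBound
      (ρ := fun i => if i < φ.varBound then ρ i else i - φ.varBound) (by simp)
    rwa [φ.subst_congr (fun _ _ => rfl) (fun i hi => if_pos hi)] at this
  generalize hψ : φ.subst .var ρ = ψ at hset
  have := hset.subst_of_eventually_var ψ.varBound
    (σ := fun i => if i < ψ.varBound then σ i else .var (i - ψ.varBound)) (by simp)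
  rw [ψ.subst_congr (fun i hi => if_pos hi) (fun _ _ => rfl), ← hψ, Fm.subst_subst] at this
  exact this

theorem Derives.subst (h : Derives T Γ φ) (σ : ℕ → Tm) (ρ : ℕ → ℕ) :
    Derives T (Γ.map (Fm.subst σ ρ)) (φ.subst σ ρ) := by
  induction h generalizing σ ρ with
  | ax h => exact (Derives.subst_nil (.ax h) σ ρ).weaken (List.nil_subset _)
  | hyp h => exact .hyp (List.mem_map_of_mem h)
  | impI _ ih => exact .impI (ih σ ρ)
  | impE _ _ ih₁ ih₂ => exact .impE (ih₁ σ ρ) (ih₂ σ ρ)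
  | raa _ ih => exact .raa (ih σ ρ)
  | allI _ ih =>
    have := ih (consVar (.var 0) fun i => (σ i).shift) ρ
    exact .allI (by simpa only [List.map_map, Function.comp_def, Fm.shift_subst] using this)
  | allE t _ ih => exact Fm.inst_subst _ t σ ρ ▸ .allE _ (ih σ ρ)
  | allSetI _ ih =>
    have := ih σ (consVar 0 fun i => ρ i + 1)
    exact .allSetI (by simpa only [List.map_map, Function.comp_def, Fm.shiftSet_subst] using this)
  | allSetE Y _ ih => exact Fm.instSet_subst _ Y σ ρ ▸ .allSetE _ (ih σ ρ)
  | eqI t => exact .eqI _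
  | eqE φ _ _ ih₁ ih₂ =>
    have := ih₂ σ ρ
    rw [Fm.inst_subst] at this ⊢
    exact .eqE _ (ih₁ σ ρ) this

theorem Derives.all_of_fresh {m : ℕ} (hΓ : ∀ ψ ∈ Γ, ψ.varBound ≤ m) (hφ : φ.varBound ≤ m)
    (h : Derives T Γ (φ.inst (.var m))) : Derives T Γ (.all φ) := by
  let σ : ℕ → Tm := fun i => if i = m then .var 0 else .var (i + 1)
  have hσ : ∀ i < m, σ i = .var (i + 1) := fun i hi => if_neg hi.ne
  have hΓσ : Γ.map (Fm.subst σ id) = Γ.map Fm.shift := List.map_congr_left fun ψ hψ =>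
    ψ.subst_congr (fun i hi => hσ i (hi.trans_le (hΓ ψ hψ))) fun _ _ => rfl
  have hφσ : (φ.inst (.var m)).subst σ id = φ := by
    rw [Fm.inst, Fm.subst_subst]
    refine (φ.subst_congr (fun i hi => ?_) fun _ _ => rfl).trans φ.subst_var
    cases i with
    | zero => simp [consVar, Tm.subst, σ]
    | succ i => exact hσ i (by omega)
  exact .allI (by simpa only [hΓσ, hφσ] using h.subst σ id)

theorem Derives.allSet_of_fresh {m : ℕ} (hΓ : ∀ ψ ∈ Γ, ψ.varBound ≤ m) (hφ : φ.varBound ≤ m)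
    (h : Derives T Γ (φ.instSet m)) : Derives T Γ (.allSet φ) := by
  let ρ : ℕ → ℕ := fun i => if i = m then 0 else i + 1
  have hρ : ∀ i < m, ρ i = i + 1 := fun i hi => if_neg hi.ne
  have hΓρ : Γ.map (Fm.subst .var ρ) = Γ.map Fm.shiftSet := List.map_congr_left fun ψ hψ =>
    ψ.subst_congr (fun _ _ => rfl) fun i hi => hρ i (hi.trans_le (hΓ ψ hψ))
  have hφρ : (φ.instSet m).subst .var ρ = φ := by
    rw [Fm.instSet, Fm.subst_subst]
    refine (φ.subst_congr (fun _ _ => rfl) fun i hi => ?_).trans φ.subst_var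
    cases i with
    | zero => simp [consVar, ρ]
    | succ i => exact hρ i (by omega)
  exact .allSetI (by simpa only [hΓρ, hφρ] using h.subst .var ρ)

end Derivations

/-! ## Henkin sets -/

section Henkin

variable {T : Set Fm} {Γ : List Fm} {Δ : Set Fm}

/-- An injective numerical code of terms, used to enumerate the formulas. -/
def Tm.code : Tm → ℕ
  | .var i => Nat.pair 0 i
  | .zero => Nat.pair 1 0
  | .one => Nat.pair 2 0
  | .add s t => Nat.pair 3 (Nat.pair s.code t.code)
  | .mul s t => Nat.pair 4 (Nat.pair s.code t.code)

theorem Tm.code_injective : Function.Injective Tm.code := by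
  intro s
  induction s with
  | var | zero | one => intro t; cases t <;> simp [Tm.code, Nat.pair_eq_pair]
  | add s t ihs iht | mul s t ihs iht =>
    intro t; cases t <;> simp only [Tm.code, Nat.pair_eq_pair]
    all_goals grind

/-- An injective numerical code of formulas, used to enumerate them. -/
def Fm.code : Fm → ℕ
  | .eq s t => Nat.pair 0 (Nat.pair s.code t.code)
  | .lt s t => Nat.pair 1 (Nat.pair s.code t.code)
  | .mem t Y => Nat.pair 2 (Nat.pair t.code Y)
  | .fls => Nat.pair 3 0
  | .imp φ ψ => Nat.pair 4 (Nat.pair φ.code ψ.code)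
  | .all φ => Nat.pair 5 φ.code
  | .allSet φ => Nat.pair 6 φ.code

theorem Fm.code_injective : Function.Injective Fm.code := by
  intro φ
  induction φ with
  | fls => intro ψ; cases ψ <;> simp [Fm.code, Nat.pair_eq_pair]
  | eq | lt | mem =>
    intro ψ; cases ψ <;> simp [Fm.code, Nat.pair_eq_pair, Tm.code_injective.eq_iff]
  | imp φ ψ ihφ ihψ =>
    intro ψ; cases ψ <;> simp only [Fm.code, Nat.pair_eq_pair]
    all_goals grind
  | all φ ih | allSet φ ih =>
    intro ψ; cases ψ <;> simp only [Fm.code, Nat.pair_eq_pair]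
    all_goals grind

instance : Countable Fm := Fm.code_injective.countable

instance : Nonempty Fm := ⟨.fls⟩

/-- No contradiction is derivable from `T` and the hypotheses `Γ`. -/
def Consistent (T : Set Fm) (Γ : List Fm) : Prop := ¬ Derives T Γ .fls

theorem Consistent.cons_or_cons_neg (h : Consistent T Γ) (ψ : Fm) :
    Consistent T (ψ :: Γ) ∨ Consistent T (ψ.neg :: Γ) := by
  by_contra! hc
  simp only [Consistent, not_not] at hc
  exact h (.impE (.impI hc.1) (.raa hc.2))

theorem Consistent.exists_cons_inst {θ : Fm} (h : Consistent T (Fm.neg (.all θ) :: Γ)) :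
    ∃ t, Consistent T ((θ.inst t).neg :: Fm.neg (.all θ) :: Γ) := by
  obtain ⟨m, hm⟩ := exists_varBound_le (.all θ :: Fm.neg (.all θ) :: Γ)
  rw [List.forall_mem_cons] at hm
  exact ⟨.var m, fun hd =>
    h (.impE (.hyp (List.mem_cons_self ..)) (Derives.all_of_fresh hm.2 hm.1 (.raa hd)))⟩

theorem Consistent.exists_cons_instSet {θ : Fm} (h : Consistent T (Fm.neg (.allSet θ) :: Γ)) :
    ∃ Y, Consistent T ((θ.instSet Y).neg :: Fm.neg (.allSet θ) :: Γ) := by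
  obtain ⟨m, hm⟩ := exists_varBound_le (.allSet θ :: Fm.neg (.allSet θ) :: Γ)
  rw [List.forall_mem_cons] at hm
  exact ⟨m, fun hd =>
    h (.impE (.hyp (List.mem_cons_self ..)) (Derives.allSet_of_fresh hm.2 hm.1 (.raa hd)))⟩

/-- If the formula is universal, `Γ` contains the negation of one of its instances. -/
def HasCounterexample (Γ : List Fm) : Fm → Prop
  | .all θ => ∃ t, (θ.inst t).neg ∈ Γ
  | .allSet θ => ∃ Y, (θ.instSet Y).neg ∈ Γ
  | _ => True

/-- `Γ` contains `ψ`, or it refutes `ψ` together with an instance of `ψ`. This is what one step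
of Henkin's construction achieves for `ψ`. -/
def Settles (Γ : List Fm) (ψ : Fm) : Prop := ψ ∈ Γ ∨ ψ.neg ∈ Γ ∧ HasCounterexample Γ ψ

theorem Consistent.exists_settles (h : Consistent T Γ) (ψ : Fm) :
    ∃ Γ', Consistent T Γ' ∧ Γ ⊆ Γ' ∧ Settles Γ' ψ := by
  rcases h.cons_or_cons_neg ψ with hψ | hψ
  · exact ⟨_, hψ, List.subset_cons_self .., .inl (List.mem_cons_self ..)⟩
  cases ψ with
  | all θ =>
    obtain ⟨t, ht⟩ := hψ.exists_cons_inst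
    exact ⟨_, ht, fun _ h => by simp [h], .inr ⟨by simp, t, by simp⟩⟩
  | allSet θ =>
    obtain ⟨Y, hY⟩ := hψ.exists_cons_instSet
    exact ⟨_, hY, fun _ h => by simp [h], .inr ⟨by simp, Y, by simp⟩⟩
  | _ => exact ⟨_, hψ, List.subset_cons_self .., .inr ⟨List.mem_cons_self .., trivial⟩⟩

theorem Consistent.exists_chain (h : Consistent T Γ) :
    ∃ G : ℕ → List Fm, G 0 = Γ ∧ (∀ n, Consistent T (G n)) ∧ (∀ m n, m ≤ n → G m ⊆ G n) ∧
      ∀ ψ, ∃ n, Settles (G n) ψ := by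
  obtain ⟨g, hg⟩ := exists_surjective_nat Fm
  choose! F hF hsub hsettles using fun Γ (ψ : Fm) (h : Consistent T Γ) => h.exists_settles ψ
  let G : ℕ → List Fm := fun n => n.rec Γ fun n Γ' => F Γ' (g n)
  have hG : ∀ n, Consistent T (G n) := fun n => n.rec h fun n ih => hF _ (g n) ih
  refine ⟨G, rfl, hG, fun m n hmn => ?_, fun ψ => ?_⟩
  · induction hmn with
    | refl => exact List.Subset.refl _
    | @step n _ ih => exact List.Subset.trans ih (hsub _ (g n) (hG n))
  · obtain ⟨n, rfl⟩ := hg ψ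
    exact ⟨n + 1, hsettles _ _ (hG n)⟩

/-- A deductively closed, complete set of formulas with witnesses for the false universal
formulas. -/
structure HenkinSet (T Δ : Set Fm) : Prop where
  closed : ∀ Γ : List Fm, (∀ ψ ∈ Γ, ψ ∈ Δ) → ∀ φ, Derives T Γ φ → φ ∈ Δ
  consistent : .fls ∉ Δ
  total : ∀ φ : Fm, φ ∉ Δ → φ.neg ∈ Δ
  witness : ∀ θ : Fm, .all θ ∉ Δ → ∃ t, θ.inst t ∉ Δ
  witnessSet : ∀ θ : Fm, .allSet θ ∉ Δ → ∃ Y, θ.instSet Y ∉ Δ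

theorem HenkinSet.of_chain {G : ℕ → List Fm} (hcons : ∀ n, Consistent T (G n))
    (hmono : ∀ m n, m ≤ n → G m ⊆ G n) (hsettles : ∀ ψ, ∃ n, Settles (G n) ψ) :
    HenkinSet T {φ | ∃ n, φ ∈ G n} := by
  have hrefuted : ∀ φ, (¬ ∃ n, φ ∈ G n) → ∃ n, φ.neg ∈ G n ∧ HasCounterexample (G n) φ :=
    fun φ hφ => (hsettles φ).imp fun n hn => hn.resolve_left fun h => hφ ⟨n, h⟩
  have hfinite : ∀ Γ : List Fm, (∀ ψ ∈ Γ, ∃ n, ψ ∈ G n) → ∃ n, Γ ⊆ G n := by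
    intro Γ hΓ
    choose! f hf using hΓ
    obtain ⟨n, hn⟩ := (Γ.finite_toSet.image f).bddAbove
    exact ⟨n, fun ψ hψ => hmono _ _ (hn ⟨ψ, hψ, rfl⟩) (hf ψ hψ)⟩
  have hclosed : ∀ Γ : List Fm, (∀ ψ ∈ Γ, ∃ n, ψ ∈ G n) → ∀ φ, Derives T Γ φ →
      ∃ n, φ ∈ G n := by
    intro Γ hΓ φ hφ
    by_contra hφG
    obtain ⟨n, hn⟩ := hfinite Γ hΓ
    obtain ⟨m, hm, -⟩ := hrefuted φ hφG
    exact hcons (max n m) (.impE (.hyp (hmono _ _ (le_max_right n m) hm))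
      (hφ.weaken (List.Subset.trans hn (hmono _ _ (le_max_left n m)))))
  have hconsistent : ¬ ∃ n, .fls ∈ G n := fun ⟨n, hn⟩ => hcons n (.hyp hn)
  have hneg : ∀ φ : Fm, (∃ n, φ.neg ∈ G n) → ¬ ∃ n, φ ∈ G n := fun φ h₁ h₂ =>
    hconsistent (hclosed [φ.neg, φ] (by simp [h₁, h₂]) _
      (.impE (.hyp (φ := φ.neg) (by simp)) (.hyp (by simp))))
  refine ⟨hclosed, hconsistent, fun φ hφ => ?_, fun θ hθ => ?_, fun θ hθ => ?_⟩
  · exact (hrefuted φ hφ).imp fun n hn => hn.1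
  · obtain ⟨n, -, t, ht⟩ := hrefuted _ hθ
    exact ⟨t, hneg _ ⟨n, ht⟩⟩
  · obtain ⟨n, -, Y, hY⟩ := hrefuted _ hθ
    exact ⟨Y, hneg _ ⟨n, hY⟩⟩

theorem Consistent.exists_henkinSet (h : Consistent T Γ) :
    ∃ Δ, HenkinSet T Δ ∧ ∀ ψ ∈ Γ, ψ ∈ Δ := by
  obtain ⟨G, rfl, hcons, hmono, hsettles⟩ := h.exists_chain
  exact ⟨_, .of_chain hcons hmono hsettles, fun ψ hψ => ⟨0, hψ⟩⟩

namespace HenkinSet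

theorem imp_iff (h : HenkinSet T Δ) {φ ψ : Fm} : (φ ➝ ψ) ∈ Δ ↔ (φ ∈ Δ → ψ ∈ Δ) := by
  refine ⟨fun hφψ hφ => h.closed [φ ➝ ψ, φ] (by simp [hφψ, hφ]) _
    (.impE (.hyp (φ := φ ➝ ψ) (by simp)) (.hyp (by simp))), fun himp => ?_⟩
  by_cases hφ : φ ∈ Δ
  · exact h.closed [ψ] (by simp [himp hφ]) _ (.impI (.hyp (by simp)))
  · exact h.closed [φ.neg] (by simp [h.total φ hφ]) _
      (.impI (.fls_elim (.impE (.hyp (φ := φ.neg) (by simp)) (.hyp (by simp)))))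

theorem all_iff (h : HenkinSet T Δ) {φ : Fm} : .all φ ∈ Δ ↔ ∀ t, φ.inst t ∈ Δ := by
  refine ⟨fun hφ t => h.closed [.all φ] (by simp [hφ]) _ (.allE t (.hyp (by simp))), ?_⟩
  contrapose!
  exact h.witness φ

theorem allSet_iff (h : HenkinSet T Δ) {φ : Fm} : .allSet φ ∈ Δ ↔ ∀ Y, φ.instSet Y ∈ Δ := by
  refine ⟨fun hφ Y => h.closed [.allSet φ] (by simp [hφ]) _ (.allSetE Y (.hyp (by simp))), ?_⟩
  contrapose!
  exact h.witnessSet φ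

theorem eq_refl (h : HenkinSet T Δ) (t : Tm) : .eq t t ∈ Δ := h.closed [] (by simp) _ (.eqI t)

theorem inst_of_eq (h : HenkinSet T Δ) {s t : Tm} (hst : .eq s t ∈ Δ) (φ : Fm)
    (hφ : φ.inst s ∈ Δ) : φ.inst t ∈ Δ :=
  h.closed [.eq s t, φ.inst s] (by simp [hst, hφ]) _
    (.eqE (s := s) φ (.hyp (by simp)) (.hyp (by simp)))

theorem eq_symm (h : HenkinSet T Δ) {s t : Tm} (hst : .eq s t ∈ Δ) : .eq t s ∈ Δ := by
  have := h.inst_of_eq hst (.eq (.var 0) s.shift)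
  simp only [Fm.inst, Fm.subst, Tm.shift_subst, Tm.subst_var] at this
  exact this (h.eq_refl s)

theorem subst_of_eq (h : HenkinSet T Δ) {s s' t t' : Tm} (hs : .eq s s' ∈ Δ) (ht : .eq t t' ∈ Δ)
    (φ : Fm) (hφ : φ.subst (consVar s (consVar t .var)) id ∈ Δ) :
    φ.subst (consVar s' (consVar t' .var)) id ∈ Δ := by
  have subst_inst : ∀ (σ : ℕ → Tm) r, (φ.subst σ id).inst r =
      φ.subst (fun i => (σ i).subst (consVar r .var)) id := fun σ r => Fm.subst_subst ..
  have hfst := h.inst_of_eq hs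
    (φ.subst (consVar (.var 0) (consVar t.shift fun i => .var (i + 1))) id)
  have hsnd := h.inst_of_eq ht
    (φ.subst (consVar s'.shift (consVar (.var 0) fun i => .var (i + 1))) id)
  simp only [subst_inst] at hfst hsnd
  convert hsnd ?_ using 2
  · funext i; rcases i with _ | _ | i <;> simp [consVar, Tm.subst, Tm.shift_subst, Tm.subst_var]
  convert hfst ?_ using 2
  · funext i; rcases i with _ | _ | i <;> simp [consVar, Tm.subst, Tm.shift_subst, Tm.subst_var]
  convert hφ using 2
  funext i; rcases i with _ | _ | i <;> simp [consVar, Tm.subst, Tm.shift_subst, Tm.subst_var]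

theorem eq_trans (h : HenkinSet T Δ) {r s t : Tm} (hrs : .eq r s ∈ Δ) (hst : .eq s t ∈ Δ) :
    .eq r t ∈ Δ :=
  h.subst_of_eq (h.eq_refl r) hst (.eq (.var 0) (.var 1)) hrs

theorem eq_op (h : HenkinSet T Δ) {s s' t t' : Tm} (hs : .eq s s' ∈ Δ) (ht : .eq t t' ∈ Δ)
    (op : Tm → Tm → Tm)
    (subst_op : ∀ s t σ, (op s t).subst σ = op (s.subst σ) (t.subst σ)) :
    .eq (op s t) (op s' t') ∈ Δ := by
  have := h.subst_of_eq hs ht (.eq (op s t).shift.shift (op (.var 0) (.var 1)))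
  simp only [Fm.subst, Tm.shift_subst, Tm.subst_var, subst_op, Tm.subst, consVar] at this
  exact this (h.eq_refl _)

/-- Equality of terms in the term model of a Henkin set. -/
def setoid (h : HenkinSet T Δ) : Setoid Tm where
  r s t := .eq s t ∈ Δ
  iseqv := ⟨h.eq_refl, h.eq_symm, h.eq_trans⟩

end HenkinSet

end Henkin

/-! ## Semantics and completeness -/

section Semantics

variable {M V : Type} [Zero M] [One M] [Add M] [Mul M]

/-- The value of a term. -/
def Tm.eval (e : ℕ → M) : Tm → M
  | .var i => e i
  | .zero => 0
  | .one => 1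
  | .add s t => s.eval e + t.eval e
  | .mul s t => s.eval e * t.eval e

/-- Satisfaction of a formula in the structure with number sort `M` and set sort `V`. -/
def Fm.Sat [LT M] [Membership M V] : (ℕ → M) → (ℕ → V) → Fm → Prop
  | e, _, .eq s t => s.eval e = t.eval e
  | e, _, .lt s t => s.eval e < t.eval e
  | e, r, .mem t Y => t.eval e ∈ r Y
  | _, _, .fls => False
  | e, r, .imp φ ψ => φ.Sat e r → ψ.Sat e r
  | e, r, .all φ => ∀ m, φ.Sat (consVar m e) r
  | e, r, .allSet φ => ∀ A, φ.Sat e (consVar A r)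

end Semantics

namespace HenkinSet

variable {T Δ : Set Fm} (h : HenkinSet T Δ)

/-- The number sort of the term model of a Henkin set: terms modulo provable equality. -/
def Model : Type := Quotient h.setoid

/-- The set sort of the term model of a Henkin set: the set variables. -/
def ModelSet (_h : HenkinSet T Δ) : Type := ℕ

/-- The element of the term model denoted by a term. -/
def toModel (t : Tm) : h.Model := Quotient.mk h.setoid t

instance : Zero h.Model := ⟨h.toModel .zero⟩

instance : One h.Model := ⟨h.toModel .one⟩

instance : Add h.Model :=
  ⟨Quotient.map₂ .add fun _ _ hs _ _ ht => h.eq_op hs ht .add fun _ _ _ => rfl⟩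

instance : Mul h.Model :=
  ⟨Quotient.map₂ .mul fun _ _ hs _ _ ht => h.eq_op hs ht .mul fun _ _ _ => rfl⟩

instance : LT h.Model :=
  ⟨Quotient.lift₂ (fun s t => .lt s t ∈ Δ) fun _ _ _ _ hs ht => propext
    ⟨h.subst_of_eq hs ht (.lt (.var 0) (.var 1)),
      h.subst_of_eq (h.eq_symm hs) (h.eq_symm ht) (.lt (.var 0) (.var 1))⟩⟩

instance : Membership h.Model h.ModelSet :=
  ⟨fun Y => Quotient.lift (fun s => .mem s Y ∈ Δ) fun _ _ hs => propext
    ⟨h.inst_of_eq hs (.mem (.var 0) Y), h.inst_of_eq (h.eq_symm hs) (.mem (.var 0) Y)⟩⟩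

theorem eval_toModel (t : Tm) (σ : ℕ → Tm) :
    t.eval (fun i => h.toModel (σ i)) = h.toModel (t.subst σ) := by
  induction t with
  | var | zero | one => rfl
  | add s t ihs iht => simp only [Tm.eval, ihs, iht]; rfl
  | mul s t ihs iht => simp only [Tm.eval, ihs, iht]; rfl

theorem sat_iff (ψ : Fm) (σ : ℕ → Tm) (ρ : ℕ → ℕ) :
    ψ.Sat (V := h.ModelSet) (fun i => h.toModel (σ i)) ρ ↔ ψ.subst σ ρ ∈ Δ := by
  induction ψ generalizing σ ρ with
  | eq s t => simp only [Fm.Sat, eval_toModel]; exact Quotient.eq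
  | lt s t | mem t Y => simp only [Fm.Sat, eval_toModel]; rfl
  | fls => exact iff_of_false id h.consistent
  | imp φ ψ ihφ ihψ => simp only [Fm.Sat, Fm.subst, ihφ, ihψ, h.imp_iff]
  | all ψ ih =>
    simp only [Fm.Sat, Fm.subst, h.all_iff, Fm.lift_subst_inst, ← ih]
    refine Quotient.mk_surjective.forall.trans (forall_congr' fun t => ?_)
    refine iff_of_eq (congrArg (Fm.Sat (V := h.ModelSet) · ρ ψ) ?_)
    funext i
    cases i <;> rfl
  | allSet ψ ih =>
    simp only [Fm.Sat, Fm.subst, h.allSet_iff, Fm.lift_subst_instSet, ← ih]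
    rfl

theorem sat_of_mem_axioms {ψ : Fm} (hψ : ψ ∈ T) (e : ℕ → h.Model) (r : ℕ → h.ModelSet) :
    ψ.Sat e r := by
  obtain ⟨σ, rfl⟩ : ∃ σ : ℕ → Tm, (fun i => h.toModel (σ i)) = e :=
    ⟨fun i => (e i).out, funext fun i => (e i).out_eq⟩
  exact (h.sat_iff ψ σ r).2 (h.closed [] (by simp) _ (Derives.subst_nil (.ax hψ) σ r))

end HenkinSet

theorem completeness {T : Set Fm} {φ : Fm}
    (h : ∀ (M V : Type) [Zero M] [One M] [Add M] [Mul M] [LT M] [Membership M V],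
      (∀ ψ ∈ T, ∀ (e : ℕ → M) (r : ℕ → V), ψ.Sat e r) →
        ∀ (e : ℕ → M) (r : ℕ → V), φ.Sat e r) : Proves T φ := by
  by_contra hφ
  have hcons : Consistent T [φ.neg] := fun hd => hφ (.raa hd)
  obtain ⟨Δ, hΔ, hφΔ⟩ := hcons.exists_henkinSet
  have hsat : ∀ ψ ∈ Δ, ψ.Sat (V := hΔ.ModelSet) (fun i => hΔ.toModel (.var i)) id := fun ψ hψ =>
    (hΔ.sat_iff ψ .var id).2 (ψ.subst_var.symm ▸ hψ)
  exact hsat _ (hφΔ φ.neg (List.mem_singleton_self _))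
    (h hΔ.Model hΔ.ModelSet (fun ψ hψ => hΔ.sat_of_mem_axioms hψ) _ id)

section Satisfaction

variable {M V : Type} [Zero M] [One M] [Add M] [Mul M]

theorem Tm.eval_subst (t : Tm) (σ : ℕ → Tm) (e : ℕ → M) :
    (t.subst σ).eval e = t.eval fun i => (σ i).eval e := by
  induction t <;> simp_all [Tm.subst, Tm.eval]

theorem Tm.eval_shift (t : Tm) (m : M) (e : ℕ → M) : t.shift.eval (consVar m e) = t.eval e :=
  t.eval_subst ..

variable [LT M] [Membership M V]

theorem Fm.sat_subst (φ : Fm) (σ : ℕ → Tm) (ρ : ℕ → ℕ) (e : ℕ → M) (r : ℕ → V) :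
    (φ.subst σ ρ).Sat e r ↔ φ.Sat (fun i => (σ i).eval e) fun i => r (ρ i) := by
  induction φ generalizing σ ρ e r with
  | eq s t | lt s t | mem s t => simp only [Fm.subst, Fm.Sat, Tm.eval_subst]
  | fls => rfl
  | imp φ ψ ihφ ihψ => simp only [Fm.subst, Fm.Sat, ihφ, ihψ]
  | all φ ih =>
    simp only [Fm.subst, Fm.Sat, ih]
    refine forall_congr' fun m => iff_of_eq (congrArg (φ.Sat · _) (funext fun i => ?_))
    cases i with
    | zero => rfl
    | succ i => exact Tm.eval_shift ..
  | allSet φ ih =>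
    simp only [Fm.subst, Fm.Sat, ih]
    refine forall_congr' fun A => iff_of_eq (congrArg (φ.Sat _ ·) (funext fun i => ?_))
    cases i <;> rfl

variable (e : ℕ → M) (r : ℕ → V) (φ ψ : Fm)

theorem Fm.sat_imp : (φ ➝ ψ).Sat e r ↔ (φ.Sat e r → ψ.Sat e r) := Iff.rfl

theorem Fm.sat_neg : φ.neg.Sat e r ↔ ¬ φ.Sat e r := Iff.rfl

theorem Fm.sat_tru : Fm.tru.Sat e r := id

theorem Fm.sat_and : (φ ⋏ ψ).Sat e r ↔ φ.Sat e r ∧ ψ.Sat e r := by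
  simp [Fm.and, Fm.neg, Fm.Sat]

theorem Fm.sat_or : (φ ⋎ ψ).Sat e r ↔ φ.Sat e r ∨ ψ.Sat e r := by
  simp only [Fm.or, Fm.neg, Fm.Sat]; tauto

theorem Fm.sat_iff : (φ ⭤ ψ).Sat e r ↔ (φ.Sat e r ↔ ψ.Sat e r) := by
  simp only [Fm.iff, Fm.sat_and, Fm.Sat]; tauto

theorem Fm.sat_ex : φ.ex.Sat e r ↔ ∃ m, φ.Sat (consVar m e) r := by
  simp [Fm.ex, Fm.neg, Fm.Sat]

theorem Fm.sat_exSet : φ.exSet.Sat e r ↔ ∃ A, φ.Sat e (consVar A r) := by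
  simp [Fm.exSet, Fm.neg, Fm.Sat]

end Satisfaction

theorem Fm.Bounded.subst {φ : Fm} (h : φ.Bounded) (σ : ℕ → Tm) (ρ : ℕ → ℕ) :
    (φ.subst σ ρ).Bounded := by
  have shift_subst_lift : ∀ (t : Tm) (σ : ℕ → Tm),
      t.shift.subst (consVar (.var 0) fun i => (σ i).shift) = (t.subst σ).shift := by
    intro t σ
    rw [Tm.shift_subst, Tm.shift, Tm.subst_subst]; rfl
  induction h generalizing σ ρ with
  | eq s t => exact .eq _ _
  | lt s t => exact .lt _ _
  | mem t Y => exact .mem _ _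
  | fls => exact .fls
  | imp _ _ ihφ ihψ => exact .imp (ihφ σ ρ) (ihψ σ ρ)
  | ball t _ ih =>
    simp only [Fm.subst, shift_subst_lift]
    exact .ball _ (ih _ _)
  | bex t _ ih =>
    simp only [Fm.ex, Fm.neg, Fm.and, Fm.subst, shift_subst_lift]
    exact .bex _ (ih _ _)

/-! ## Definability by bounded formulas with parameters -/

section Definability

variable {M V : Type} [Add M] [Mul M]

/-- Polynomial functions of finitely many of the variables `e i`, with parameters from `M`: the
functions given by the terms of the language. -/
class inductive TermDefinable : ((ℕ → M) → M) → Prop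
  | var (i : ℕ) : TermDefinable fun e => e i
  | const (m : M) : TermDefinable fun _ => m
  | add {s t : (ℕ → M) → M} : TermDefinable s → TermDefinable t → TermDefinable fun e => s e + t e
  | mul {s t : (ℕ → M) → M} : TermDefinable s → TermDefinable t → TermDefinable fun e => s e * t e

theorem TermDefinable.comp {t : (ℕ → M) → M} (ht : TermDefinable t) (σ : ℕ → (ℕ → M) → M)
    (hσ : ∀ i, TermDefinable (σ i)) : TermDefinable fun e => t fun i => σ i e := by
  induction ht with
  | var i => exact hσ i
  | const m => exact .const m
  | add _ _ ihs iht => exact .add ihs iht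
  | mul _ _ ihs iht => exact .mul ihs iht

variable (V) [LT M] [Membership M V]

/-- Predicates of the variables `e i` that are defined by a bounded formula with parameters from
`M` and `V`. In `ball` the bound variable gets the index `0` and the others are shifted. -/
class inductive BoundedDefinable : ((ℕ → M) → Prop) → Prop
  | const (q : Prop) : BoundedDefinable fun _ => q
  | eq {s t : (ℕ → M) → M} : TermDefinable s → TermDefinable t →
      BoundedDefinable fun e => s e = t e
  | lt {s t : (ℕ → M) → M} : TermDefinable s → TermDefinable t →
      BoundedDefinable fun e => s e < t e
  | mem {t : (ℕ → M) → M} (A : V) : TermDefinable t → BoundedDefinable fun e => t e ∈ A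
  | imp {P Q : (ℕ → M) → Prop} : BoundedDefinable P → BoundedDefinable Q →
      BoundedDefinable fun e => P e → Q e
  | ball {t : (ℕ → M) → M} {P : (ℕ → M) → M → Prop} : TermDefinable t →
      BoundedDefinable (fun e => P (fun i => e (i + 1)) (e 0)) →
      BoundedDefinable fun e => ∀ m, m < t e → P e m

variable {V}

section Instances

variable {s t : (ℕ → M) → M} {P Q : (ℕ → M) → Prop}

instance (i : ℕ) : TermDefinable fun e : ℕ → M => e i := .var i

instance (m : M) : TermDefinable fun _ : ℕ → M => m := .const m

instance [hs : TermDefinable s] [ht : TermDefinable t] : TermDefinable fun e => s e + t e :=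
  .add hs ht

instance [hs : TermDefinable s] [ht : TermDefinable t] : TermDefinable fun e => s e * t e :=
  .mul hs ht

instance (q : Prop) : BoundedDefinable V fun _ : ℕ → M => q := .const q

instance [hs : TermDefinable s] [ht : TermDefinable t] : BoundedDefinable V fun e => s e = t e :=
  .eq hs ht

instance [hs : TermDefinable s] [ht : TermDefinable t] : BoundedDefinable V fun e => s e < t e :=
  .lt hs ht

instance [ht : TermDefinable t] (A : V) : BoundedDefinable V fun e => t e ∈ A := .mem A ht

instance [hP : BoundedDefinable V P] [hQ : BoundedDefinable V Q] :
    BoundedDefinable V fun e => P e → Q e :=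
  .imp hP hQ

instance {P : (ℕ → M) → M → Prop} [ht : TermDefinable t]
    [hP : BoundedDefinable V fun e => P (fun i => e (i + 1)) (e 0)] :
    BoundedDefinable V fun e => ∀ m, m < t e → P e m :=
  .ball ht hP

theorem BoundedDefinable.congr (hP : BoundedDefinable V P) (h : ∀ e, P e ↔ Q e) :
    BoundedDefinable V Q :=
  (funext fun e => propext (h e) : P = Q) ▸ hP

instance [BoundedDefinable V P] : BoundedDefinable V fun e => ¬ P e :=
  inferInstanceAs (BoundedDefinable V fun e => P e → False)

instance [BoundedDefinable V P] [BoundedDefinable V Q] : BoundedDefinable V fun e => P e ∧ Q e :=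
  (inferInstance : BoundedDefinable V fun e => ¬ (P e → ¬ Q e)).congr fun e => by tauto

instance [BoundedDefinable V P] [BoundedDefinable V Q] : BoundedDefinable V fun e => P e ∨ Q e :=
  (inferInstance : BoundedDefinable V fun e => ¬ P e → Q e).congr fun e => by tauto

instance [BoundedDefinable V P] [BoundedDefinable V Q] : BoundedDefinable V fun e => (P e ↔ Q e) :=
  (inferInstance : BoundedDefinable V fun e => (P e → Q e) ∧ (Q e → P e)).congr fun e => by tauto

instance {P : (ℕ → M) → M → Prop} [TermDefinable t]
    [BoundedDefinable V fun e => P (fun i => e (i + 1)) (e 0)] :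
    BoundedDefinable V fun e => ∃ m, m < t e ∧ P e m :=
  (inferInstance : BoundedDefinable V fun e => ¬ ∀ m, m < t e → ¬ P e m).congr
    fun e => by push Not; rfl

end Instances

theorem BoundedDefinable.comp {P : (ℕ → M) → Prop} (hP : BoundedDefinable V P)
    (σ : ℕ → (ℕ → M) → M) (hσ : ∀ i, TermDefinable (σ i)) :
    BoundedDefinable V fun e => P fun i => σ i e := by
  induction hP generalizing σ with
  | const q => exact .const q
  | eq hs ht => exact .eq (hs.comp σ hσ) (ht.comp σ hσ)
  | lt hs ht => exact .lt (hs.comp σ hσ) (ht.comp σ hσ)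
  | mem A ht => exact .mem A (ht.comp σ hσ)
  | imp _ _ ihP ihQ => exact .imp (ihP σ hσ) (ihQ σ hσ)
  | ball ht _ ih =>
    refine .ball (ht.comp σ hσ)
      (ih (fun i e => consVar (e 0) (fun i => σ i fun j => e (j + 1)) i) ?_)
    rintro (_ | i)
    · exact .var 0
    · exact (hσ i).comp _ fun j => .var (j + 1)

end Definability

/-! ### Defining formulas -/

section DefiningFormulas

/-- The sequence with `f` at the even and `g` at the odd places. -/
def interleave {α : Type} (f g : ℕ → α) (i : ℕ) : α := if i % 2 = 0 then f (i / 2) else g (i / 2)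

theorem interleave_two_mul {α : Type} (f g : ℕ → α) (i : ℕ) : interleave f g (2 * i) = f i := by
  simp [interleave]

theorem interleave_two_mul_add_one {α : Type} (f g : ℕ → α) (i : ℕ) :
    interleave f g (2 * i + 1) = g i := by
  simp [interleave, Nat.add_mod, Nat.mul_add_div]

variable {M V : Type}

/-- The assignment in which the variable `i` is an argument of `e` or a parameter, as told
by `g i`. -/
def assign (g : ℕ → ℕ ⊕ M) (e : ℕ → M) (i : ℕ) : M := Sum.elim e id (g i)

variable [Zero M] [One M] [Add M] [Mul M]

/-- The term `s` defines the function `t`, with the parameters in `g`. -/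
def Tm.Defines (s : Tm) (g : ℕ → ℕ ⊕ M) (t : (ℕ → M) → M) : Prop :=
  ∀ e, s.eval (assign g e) = t e

theorem Tm.Defines.evens {s : Tm} {g : ℕ → ℕ ⊕ M} {t : (ℕ → M) → M} (h : s.Defines g t)
    (g' : ℕ → ℕ ⊕ M) : (s.subst fun i => .var (2 * i)).Defines (interleave g g') t := fun e => by
  rw [Tm.eval_subst, ← h e]
  simp only [Tm.eval, assign, interleave_two_mul]; rfl

theorem Tm.Defines.odds {s : Tm} {g : ℕ → ℕ ⊕ M} {t : (ℕ → M) → M} (h : s.Defines g t)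
    (g' : ℕ → ℕ ⊕ M) : (s.subst fun i => .var (2 * i + 1)).Defines (interleave g' g) t :=
  fun e => by
    rw [Tm.eval_subst, ← h e]
    simp only [Tm.eval, assign, interleave_two_mul_add_one]; rfl

theorem TermDefinable.exists_defines {t : (ℕ → M) → M} (ht : TermDefinable t) :
    ∃ (s : Tm) (g : ℕ → ℕ ⊕ M), s.Defines g t := by
  induction ht with
  | var i => exact ⟨.var i, .inl, fun _ => rfl⟩
  | const m => exact ⟨.var 0, fun _ => .inr m, fun _ => rfl⟩
  | add _ _ ihs iht =>
    obtain ⟨s, g, hs⟩ := ihs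
    obtain ⟨t, g', ht⟩ := iht
    exact ⟨.add _ _, _, fun e => congrArg₂ (· + ·) (hs.evens g' e) (ht.odds g e)⟩
  | mul _ _ ihs iht =>
    obtain ⟨s, g, hs⟩ := ihs
    obtain ⟨t, g', ht⟩ := iht
    exact ⟨.mul _ _, _, fun e => congrArg₂ (· * ·) (hs.evens g' e) (ht.odds g e)⟩

theorem TermDefinable.exists_defines₂ {s t : (ℕ → M) → M} (hs : TermDefinable s)
    (ht : TermDefinable t) :
    ∃ (s' t' : Tm) (g : ℕ → ℕ ⊕ M), s'.Defines g s ∧ t'.Defines g t := by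
  obtain ⟨s, g, hs⟩ := hs.exists_defines
  obtain ⟨t, g', ht⟩ := ht.exists_defines
  exact ⟨_, _, _, hs.evens g', ht.odds g⟩

variable [LT M] [Membership M V]

/-- The formula `φ` defines the predicate `P`, with the parameters in `g` and `r`. -/
def Fm.Defines (φ : Fm) (g : ℕ → ℕ ⊕ M) (r : ℕ → V) (P : (ℕ → M) → Prop) : Prop :=
  ∀ e, φ.Sat (assign g e) r ↔ P e

section

variable {φ : Fm} {g : ℕ → ℕ ⊕ M} {r : ℕ → V} {P : (ℕ → M) → Prop}

theorem Fm.Defines.evens (h : φ.Defines g r P) (g' : ℕ → ℕ ⊕ M) (r' : ℕ → V) :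
    (φ.subst (fun i => .var (2 * i)) (2 * ·)).Defines (interleave g g') (interleave r r') P :=
  fun e => by
    rw [Fm.sat_subst, ← h e]
    simp only [Tm.eval, assign, interleave_two_mul]; rfl

theorem Fm.Defines.odds (h : φ.Defines g r P) (g' : ℕ → ℕ ⊕ M) (r' : ℕ → V) :
    (φ.subst (fun i => .var (2 * i + 1)) (2 * · + 1)).Defines (interleave g' g)
      (interleave r' r) P := fun e => by
  rw [Fm.sat_subst, ← h e]
  simp only [Tm.eval, assign, interleave_two_mul_add_one]; rfl

theorem Fm.Defines.ball {s : Tm} {t : (ℕ → M) → M} {P : (ℕ → M) → M → Prop} {g' : ℕ → ℕ ⊕ M}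
    (hs : s.Defines g' t) (hφ : φ.Defines g r fun e => P (fun i => e (i + 1)) (e 0)) :
    ∃ (s' : Tm) (σ : ℕ → Tm) (g'' : ℕ → ℕ ⊕ M),
      (Fm.all (.lt (.var 0) s'.shift ➝ φ.subst σ id)).Defines g'' r
        fun e => ∀ m, m < t e → P e m := by
  refine ⟨s.subst fun i => .var (2 * i),
    fun i => (g i).elim (fun l => if l = 0 then .var 0 else .var (2 * i + 1 + 1))
      fun _ => .var (2 * i + 1 + 1),
    interleave g' fun i => (g i).map Nat.pred id, fun e => ?_⟩
  simp only [Fm.Sat, Tm.eval_shift, hs.evens _ e, Fm.sat_subst]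
  refine forall_congr' fun m => imp_congr Iff.rfl ((iff_of_eq ?_).trans (hφ (consVar m e)))
  refine congrArg (φ.Sat · r) (funext fun i => ?_)
  rcases hi : g i with (_ | l) | p <;>
    simp [Tm.eval, assign, consVar, hi, interleave_two_mul_add_one]

end

theorem BoundedDefinable.exists_defines [Nonempty V] {P : (ℕ → M) → Prop}
    (hP : BoundedDefinable V P) :
    ∃ (φ : Fm) (g : ℕ → ℕ ⊕ M) (r : ℕ → V), φ.Bounded ∧ φ.Defines g r P := by
  induction hP with
  | const q =>
    by_cases hq : q
    · exact ⟨.tru, .inl, Classical.arbitrary _, .imp .fls .fls, fun _ => iff_of_true id hq⟩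
    · exact ⟨.fls, .inl, Classical.arbitrary _, .fls, fun _ => iff_of_false id hq⟩
  | eq hs ht =>
    obtain ⟨s, t, g, hs, ht⟩ := hs.exists_defines₂ ht
    exact ⟨.eq s t, g, Classical.arbitrary _, .eq _ _, fun e => by rw [Fm.Sat, hs e, ht e]⟩
  | lt hs ht =>
    obtain ⟨s, t, g, hs, ht⟩ := hs.exists_defines₂ ht
    exact ⟨.lt s t, g, Classical.arbitrary _, .lt _ _, fun e => by rw [Fm.Sat, hs e, ht e]⟩
  | mem A ht =>
    obtain ⟨t, g, ht⟩ := ht.exists_defines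
    exact ⟨.mem t 0, g, fun _ => A, .mem _ _, fun e => by rw [Fm.Sat, ht e]⟩
  | imp _ _ ihP ihQ =>
    obtain ⟨φ, g, r, hφ, hP⟩ := ihP
    obtain ⟨ψ, g', r', hψ, hQ⟩ := ihQ
    exact ⟨_, _, _, .imp (hφ.subst _ _) (hψ.subst _ _),
      fun e => imp_congr (hP.evens g' r' e) (hQ.odds g r e)⟩
  | ball ht _ ih =>
    obtain ⟨s, g', hs⟩ := ht.exists_defines
    obtain ⟨φ, g, r, hφ, hP⟩ := ih
    obtain ⟨s', σ, g'', h⟩ := Fm.Defines.ball hs hP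
    exact ⟨_, g'', r, .ball s' (hφ.subst σ id), h⟩

theorem BoundedDefinable.exists_defines₂ [Nonempty V] {P Q : (ℕ → M) → Prop}
    (hP : BoundedDefinable V P) (hQ : BoundedDefinable V Q) :
    ∃ (φ ψ : Fm) (g : ℕ → ℕ ⊕ M) (r : ℕ → V),
      φ.Bounded ∧ ψ.Bounded ∧ φ.Defines g r P ∧ ψ.Defines g r Q := by
  obtain ⟨φ, g, r, hφ, hP⟩ := hP.exists_defines
  obtain ⟨ψ, g', r', hψ, hQ⟩ := hQ.exists_defines
  exact ⟨_, _, _, _, hφ.subst _ _, hψ.subst _ _, hP.evens g' r', hQ.odds g r⟩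

/-- The substitution after which `1` and `0` are the variables for the arguments `0` and `1`, while
the parameters are in the variables from `2` on. -/
def binarySubst (g : ℕ → ℕ ⊕ M) (i : ℕ) : Tm :=
  (g i).elim (fun l => if l = 0 then .var 1 else .var 0) fun _ => .var (i + 2)

theorem Fm.Defines.sat_binarySubst {φ : Fm} {g : ℕ → ℕ ⊕ M} {r : ℕ → V} {P : M → M → Prop}
    (h : φ.Defines g r fun e => P (e 0) (e 1)) (n m : M) :
    (φ.subst (binarySubst g) id).Sat (consVar m (consVar n (assign g 0))) r ↔ P n m := by
  rw [Fm.sat_subst]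
  refine (iff_of_eq ?_).trans (h (consVar n fun _ => m))
  refine congrArg (φ.Sat · r) (funext fun i => ?_)
  rcases hi : g i with (_ | l) | p <;> simp [binarySubst, hi, Tm.eval, consVar, assign]

end DefiningFormulas

/-! ## Models of `RCA₀` -/

section Models

variable {M V : Type} [Zero M] [One M] [Add M] [Mul M] [LT M] [Membership M V]

variable (M V) in
/-- The structure with number sort `M` and set sort `V` is a model of `RCA₀`. -/
def IsModel : Prop := ∀ φ ∈ RCA0, ∀ (e : ℕ → M) (r : ℕ → V), φ.Sat e r

namespace IsModel

variable (hM : IsModel M V)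

include hM

theorem sat_basic (r : ℕ → V) {φ : Fm} (hφ : BasicAxiom φ) (m n : M) :
    φ.Sat (consVar m fun _ => n) r := hM _ (.basic hφ) _ _

variable [Nonempty V]

theorem sigma_induction {P : M → M → Prop}
    (hP : BoundedDefinable V fun e : ℕ → M => P (e 0) (e 1)) (h0 : ∃ m, P 0 m)
    (hs : ∀ n, (∃ m, P n m) → ∃ m, P (n + 1) m) (n : M) : ∃ m, P n m := by
  obtain ⟨φ, g, r, hφ, hPφ⟩ := hP.exists_defines
  let θ := Fm.ex (φ.subst (binarySubst g) id)
  have sat_θ (n : M) : θ.Sat (consVar n (assign g 0)) r ↔ ∃ m, P n m := by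
    simp only [θ, Fm.sat_ex, hPφ.sat_binarySubst]
  have sat_subst (t : Tm) (σ : ℕ → Tm) (e : ℕ → M) (hσ : ∀ i, (σ i).eval e = assign g 0 i) :
      (θ.subst (consVar t σ) id).Sat e r ↔ ∃ m, P (t.eval e) m := by
    rw [Fm.sat_subst, ← sat_θ]
    refine iff_of_eq (congrArg (θ.Sat · r) (funext fun i => ?_))
    cases i with
    | zero => rfl
    | succ i => exact hσ i
  have h := hM _ (.induction (φ := θ) ⟨_, hφ.subst _ _, rfl⟩) (assign g 0) r
  simp only [inductionAxiom, Fm.sat_imp, Fm.sat_and, Fm.Sat, Fm.inst] at h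
  refine (sat_θ n).1 (h ⟨(sat_subst _ _ _ fun i => rfl).2 h0, fun n hn => ?_⟩ n)
  exact (sat_subst _ _ _ fun i => rfl).2 (hs n ((sat_θ n).1 hn))

theorem induction {P : M → Prop} (hP : BoundedDefinable V fun e : ℕ → M => P (e 0)) (h0 : P 0)
    (hs : ∀ n, P n → P (n + 1)) (n : M) : P n :=
  (hM.sigma_induction (P := fun n _ => P n) hP ⟨0, h0⟩ (fun n ⟨m, hm⟩ => ⟨m, hs n hm⟩) n).elim
    fun _ h => h

theorem comprehension {P Q : M → M → Prop}
    (hP : BoundedDefinable V fun e : ℕ → M => P (e 0) (e 1))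
    (hQ : BoundedDefinable V fun e : ℕ → M => Q (e 0) (e 1))
    (h : ∀ n, (∃ m, P n m) ↔ ∀ m, Q n m) : ∃ A : V, ∀ n, n ∈ A ↔ ∃ m, P n m := by
  obtain ⟨φ, ψ, g, r, hφ, hψ, hPφ, hQψ⟩ := hP.exists_defines₂ hQ
  have hA := hM _ (.comprehension (φ := .ex (φ.subst (binarySubst g) id))
    (ψ := .all (ψ.subst (binarySubst g) id)) ⟨_, hφ.subst _ _, rfl⟩ ⟨_, hψ.subst _ _, rfl⟩)
    (assign g 0) r
  simp only [comprehensionAxiom, Fm.sat_imp, Fm.sat_exSet] at hA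
  obtain ⟨A, hA⟩ := hA fun n => by
    simpa only [Fm.sat_iff, Fm.sat_ex, Fm.Sat, hPφ.sat_binarySubst, hQψ.sat_binarySubst] using h n
  refine ⟨A, fun n => ?_⟩
  have hn := hA n
  rw [Fm.sat_iff, Fm.shiftSet, Fm.sat_subst, Fm.sat_ex] at hn
  exact hn.trans (exists_congr (hPφ.sat_binarySubst n))

theorem exists_set {P : M → Prop} (hP : BoundedDefinable V fun e : ℕ → M => P (e 0)) :
    ∃ A : V, ∀ n, n ∈ A ↔ P n := by
  obtain ⟨A, hA⟩ := hM.comprehension (P := fun n _ => P n) (Q := fun n _ => P n) hP hP fun n =>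
    ⟨fun ⟨_, h⟩ _ => h, fun h => ⟨0, h 0⟩⟩
  exact ⟨A, fun n => (hA n).trans ⟨fun ⟨_, h⟩ => h, fun h => ⟨0, h⟩⟩⟩

end IsModel

end Models

/-! ## Arithmetic in a model -/

section Arithmetic

variable {M V : Type} [Zero M] [One M] [Add M] [Mul M] [LT M] [Membership M V] [Nonempty V]

namespace IsModel

variable (hM : IsModel M V)

include hM

protected theorem succ_ne_zero (m : M) : m + 1 ≠ 0 :=
  hM.sat_basic (fun _ => Classical.arbitrary V) .succ_ne_zero m m

protected theorem succ_inj (m n : M) : m + 1 = n + 1 → m = n :=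
  hM.sat_basic (fun _ => Classical.arbitrary V) .succ_inj m n

protected theorem add_zero (m : M) : m + 0 = m :=
  hM.sat_basic (fun _ => Classical.arbitrary V) .add_zero m m

protected theorem add_succ (m n : M) : m + (n + 1) = m + n + 1 :=
  hM.sat_basic (fun _ => Classical.arbitrary V) .add_succ m n

protected theorem mul_zero (m : M) : m * 0 = 0 :=
  hM.sat_basic (fun _ => Classical.arbitrary V) .mul_zero m m

protected theorem mul_succ (m n : M) : m * (n + 1) = m * n + m :=
  hM.sat_basic (fun _ => Classical.arbitrary V) .mul_succ m n

protected theorem not_lt_zero (m : M) : ¬ m < 0 :=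
  hM.sat_basic (fun _ => Classical.arbitrary V) .not_lt_zero m m

protected theorem lt_succ (m n : M) : m < n + 1 ↔ m < n ∨ m = n := by
  have h := hM.sat_basic (fun _ => Classical.arbitrary V) .lt_succ m n
  rwa [Fm.sat_iff, Fm.sat_or] at h

protected theorem zero_add (m : M) : 0 + m = m := by
  refine hM.induction (P := fun m => 0 + m = m) inferInstance (hM.add_zero 0) (fun n h => ?_) m
  rw [hM.add_succ, h]

protected theorem succ_add (m n : M) : m + 1 + n = m + n + 1 := by
  refine hM.induction (P := fun n => m + 1 + n = m + n + 1) inferInstance ?_ (fun n h => ?_) n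
  · rw [hM.add_zero, hM.add_zero]
  · rw [hM.add_succ, h, hM.add_succ]

protected theorem add_comm (m n : M) : m + n = n + m := by
  refine hM.induction (P := fun n => m + n = n + m) inferInstance ?_ (fun n h => ?_) n
  · rw [hM.add_zero, hM.zero_add]
  · rw [hM.add_succ, h, hM.succ_add]

protected theorem add_assoc (l m n : M) : l + m + n = l + (m + n) := by
  refine hM.induction (P := fun n => l + m + n = l + (m + n)) inferInstance ?_ (fun n h => ?_) n
  · rw [hM.add_zero, hM.add_zero]
  · rw [hM.add_succ, h, hM.add_succ, hM.add_succ]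

protected theorem zero_mul (m : M) : 0 * m = 0 := by
  refine hM.induction (P := fun m => 0 * m = 0) inferInstance (hM.mul_zero 0) (fun n h => ?_) m
  rw [hM.mul_succ, h, hM.add_zero]

protected theorem succ_mul (m n : M) : (m + 1) * n = m * n + n := by
  refine hM.induction (P := fun n => (m + 1) * n = m * n + n) inferInstance ?_ (fun n h => ?_) n
  · rw [hM.mul_zero, hM.mul_zero, hM.add_zero]
  · rw [hM.mul_succ, h, hM.mul_succ, hM.add_assoc, hM.add_assoc, hM.add_succ n, hM.add_succ m,
      hM.add_comm n]

protected theorem mul_comm (m n : M) : m * n = n * m := by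
  refine hM.induction (P := fun n => m * n = n * m) inferInstance ?_ (fun n h => ?_) n
  · rw [hM.mul_zero, hM.zero_mul]
  · rw [hM.mul_succ, h, hM.succ_mul]

protected theorem mul_add (l m n : M) : l * (m + n) = l * m + l * n := by
  refine hM.induction (P := fun n => l * (m + n) = l * m + l * n) inferInstance ?_
    (fun n h => ?_) n
  · rw [hM.mul_zero, hM.add_zero, hM.add_zero]
  · rw [hM.add_succ, hM.mul_succ, h, hM.mul_succ, hM.add_assoc]

protected theorem mul_assoc (l m n : M) : l * m * n = l * (m * n) := by
  refine hM.induction (P := fun n => l * m * n = l * (m * n)) inferInstance ?_ (fun n h => ?_) n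
  · rw [hM.mul_zero, hM.mul_zero, hM.mul_zero]
  · rw [hM.mul_succ, h, hM.mul_succ, hM.mul_add]

protected theorem one_mul (m : M) : 1 * m = m := by
  rw [← hM.zero_add 1, hM.succ_mul, hM.zero_mul, hM.zero_add]

protected theorem add_right_cancel (l m n : M) : l + n = m + n → l = m := by
  refine hM.induction (P := fun n => l + n = m + n → l = m) inferInstance ?_ (fun n h h' => ?_) n
  · rw [hM.add_zero, hM.add_zero]; exact id
  · rw [hM.add_succ, hM.add_succ] at h'
    exact h (hM.succ_inj _ _ h')

protected theorem lt_iff_exists_add_succ (m n : M) : m < n ↔ ∃ l, m + (l + 1) = n := by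
  constructor
  · intro hmn
    refine (hM.sigma_induction (P := fun n l => m < n → m + (l + 1) = n) inferInstance
      ⟨0, fun h => (hM.not_lt_zero m h).elim⟩ (fun n ⟨l, hl⟩ => ?_) n).imp fun l hl => hl hmn
    by_cases h : m < n
    · exact ⟨l + 1, fun _ => by rw [hM.add_succ, hl h]⟩
    · refine ⟨0, fun h' => ?_⟩
      rw [hM.zero_add, ((hM.lt_succ m n).1 h').resolve_left h]
  · rintro ⟨l, rfl⟩
    refine hM.induction (P := fun l => m < m + (l + 1)) inferInstance ?_ (fun l h => ?_) l
    · rw [hM.zero_add]; exact (hM.lt_succ m m).2 (.inr rfl)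
    · rw [hM.add_succ]; exact (hM.lt_succ _ _).2 (.inl h)

protected theorem eq_zero_or_succ (m : M) : m = 0 ∨ ∃ n, m = n + 1 := by
  by_cases h : m = 0
  · exact .inl h
  obtain ⟨n, hn⟩ := hM.sigma_induction (P := fun m n => m = 0 ∨ m = n + 1) inferInstance
    ⟨0, .inl rfl⟩ (fun n _ => ⟨n, .inr rfl⟩) m
  exact hn.imp_right fun h => ⟨n, h⟩

protected theorem succ_eq_or_succ_lt {m n : M} (h : m < n) : m + 1 = n ∨ m + 1 < n := by
  obtain ⟨l, rfl⟩ := (hM.lt_iff_exists_add_succ _ _).1 h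
  rcases hM.eq_zero_or_succ l with rfl | ⟨i, rfl⟩
  · exact .inl (by rw [hM.zero_add])
  · exact .inr ((hM.lt_iff_exists_add_succ _ _).2 ⟨i, by rw [hM.succ_add, ← hM.add_succ]⟩)

protected theorem lt_trichotomy (m n : M) : m < n ∨ m = n ∨ n < m := by
  refine hM.induction (P := fun m => m < n ∨ m = n ∨ n < m) inferInstance ?_ (fun m h => ?_) m
  · rcases hM.eq_zero_or_succ n with h | ⟨l, h⟩
    · exact .inr (.inl h.symm)
    · exact .inl ((hM.lt_iff_exists_add_succ _ _).2 ⟨l, by rw [hM.zero_add, h]⟩)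
  · rcases h with h | h | h
    · exact (hM.succ_eq_or_succ_lt h).elim (fun h => .inr (.inl h)) .inl
    · exact .inr (.inr ((hM.lt_succ _ _).2 (.inr h.symm)))
    · exact .inr (.inr ((hM.lt_succ _ _).2 (.inl h)))

protected theorem lt_irrefl (m : M) : ¬ m < m := by
  intro h
  obtain ⟨l, hl⟩ := (hM.lt_iff_exists_add_succ _ _).1 h
  refine hM.succ_ne_zero l (hM.add_right_cancel _ _ m ?_)
  rw [hM.zero_add, hM.add_comm, hl]

protected theorem lt_trans (l m n : M) (h1 : l < m) (h2 : m < n) : l < n := by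
  obtain ⟨i, rfl⟩ := (hM.lt_iff_exists_add_succ _ _).1 h1
  obtain ⟨j, rfl⟩ := (hM.lt_iff_exists_add_succ _ _).1 h2
  exact (hM.lt_iff_exists_add_succ _ _).2
    ⟨i + 1 + j, by rw [hM.add_assoc l, hM.add_succ (i + 1)]⟩

omit hM

/-- The number sort of a model of `RCA₀` as a commutative semiring. -/
abbrev commSemiring (hM : IsModel M V) : CommSemiring M where
  add_assoc := hM.add_assoc
  zero_add := hM.zero_add
  add_zero := hM.add_zero
  add_comm := hM.add_comm
  nsmul := nsmulRec
  left_distrib := hM.mul_add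
  right_distrib l m n := by rw [hM.mul_comm, hM.mul_add, hM.mul_comm n, hM.mul_comm n]
  zero_mul := hM.zero_mul
  mul_zero := hM.mul_zero
  mul_assoc := hM.mul_assoc
  one_mul := hM.one_mul
  mul_one m := by rw [hM.mul_comm, hM.one_mul]
  mul_comm := hM.mul_comm

open Classical in
/-- The number sort of a model of `RCA₀` as a linear order. -/
noncomputable abbrev linearOrder (hM : IsModel M V) : LinearOrder M where
  le m n := m < n ∨ m = n
  le_refl m := .inr rfl
  le_trans l m n := by
    rintro (h | rfl) (h' | rfl)
    exacts [.inl (hM.lt_trans _ _ _ h h'), .inl h, .inl h', .inr rfl]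
  lt_iff_le_not_ge m n := by
    refine ⟨fun h => ⟨.inl h, ?_⟩, fun ⟨h, h'⟩ => h.resolve_right fun h => h' (.inr h.symm)⟩
    rintro (h' | rfl)
    · exact hM.lt_irrefl _ (hM.lt_trans _ _ _ h h')
    · exact hM.lt_irrefl _ h
  le_antisymm m n := by
    rintro (h | rfl) (h' | h')
    exacts [(hM.lt_irrefl _ (hM.lt_trans _ _ _ h h')).elim, h'.symm, rfl, rfl]
  le_total m n := by
    rcases hM.lt_trichotomy m n with h | h | h
    exacts [.inl (.inl h), .inl (.inr h), .inr (.inl h)]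
  toDecidableLE := Classical.decRel _

theorem canonicallyOrderedAdd (hM : IsModel M V) :
    letI := hM.commSemiring
    letI := hM.linearOrder
    CanonicallyOrderedAdd M := by
  let _ := hM.commSemiring
  let _ := hM.linearOrder
  have le_self_add (m n : M) : m ≤ m + n := by
    rcases hM.eq_zero_or_succ n with rfl | ⟨l, rfl⟩
    · simp
    · exact .inl ((hM.lt_iff_exists_add_succ _ _).2 ⟨l, rfl⟩)
  exact
    { exists_add_of_le := by
        rintro m n (h | rfl)
        · obtain ⟨i, rfl⟩ := (hM.lt_iff_exists_add_succ _ _).1 h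
          exact ⟨_, rfl⟩
        · exact ⟨0, by simp⟩
      le_add_self := fun m n => add_comm m n ▸ le_self_add m n
      le_self_add }

theorem isStrictOrderedRing (hM : IsModel M V) :
    letI := hM.commSemiring
    letI := hM.linearOrder
    IsStrictOrderedRing M := by
  let _ := hM.commSemiring
  let _ := hM.linearOrder
  have add_lt_add (l m n : M) (h : l < m) : n + l < n + m := by
    obtain ⟨i, rfl⟩ := (hM.lt_iff_exists_add_succ _ _).1 h
    exact (hM.lt_iff_exists_add_succ _ _).2 ⟨i, by ring⟩
  have mul_lt_mul (l m n : M) (h : 0 < l) (h' : m < n) : l * m < l * n := by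
    obtain ⟨i, rfl⟩ := (hM.lt_iff_exists_add_succ _ _).1 h
    obtain ⟨j, rfl⟩ := (hM.lt_iff_exists_add_succ _ _).1 h'
    exact (hM.lt_iff_exists_add_succ _ _).2 ⟨i * j + i + j, by ring⟩
  have zero_lt_one : (0 : M) < 1 := (hM.lt_iff_exists_add_succ _ _).2 ⟨0, by ring⟩
  exact
    { add_le_add_left := fun l m h n =>
        h.elim (fun h => .inl (by simpa only [add_comm] using add_lt_add l m n h))
          fun h => by rw [h]
      le_of_add_le_add_left := fun l m n h =>
        not_lt.1 fun h' => not_lt.2 h (add_lt_add n m l h')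
      zero_le_one := zero_lt_one.le
      exists_pair_ne := ⟨0, 1, zero_lt_one.ne⟩
      mul_lt_mul_of_pos_left := fun {l} hl {m n} h => mul_lt_mul l m n hl h
      mul_lt_mul_of_pos_right := fun {l} hl {m n} h => by
        simpa only [mul_comm] using mul_lt_mul l m n hl h }

/-- The successor order of the number sort of a model of `RCA₀`. -/
noncomputable abbrev succAddOrder (hM : IsModel M V) :
    letI := hM.linearOrder
    SuccAddOrder M :=
  letI := hM.linearOrder
  { SuccOrder.ofSuccLeIff (· + 1) fun {m n} => by
      refine ⟨fun h => ?_, fun h => (hM.succ_eq_or_succ_lt h).symm⟩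
      exact lt_of_lt_of_le ((hM.lt_succ m m).2 (.inr rfl)) h with
    succ_eq_add_one := fun _ => rfl }

end IsModel

theorem rca0_proves {φ : Fm}
    (h : ∀ (M V : Type) [CommSemiring M] [LinearOrder M] [IsStrictOrderedRing M]
      [CanonicallyOrderedAdd M] [SuccAddOrder M] [Sub M] [OrderedSub M] [Membership M V]
      [Nonempty V], IsModel M V → ∀ (e : ℕ → M) (r : ℕ → V), φ.Sat e r) : Proves RCA0 φ := by
  refine completeness fun M V _ _ _ _ _ _ hM e r => ?_
  have hM : IsModel M V := hM
  have : Nonempty V := ⟨r 0⟩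
  let _ := hM.commSemiring
  let _ := hM.linearOrder
  have := hM.isStrictOrderedRing
  have := hM.canonicallyOrderedAdd
  let _ := hM.succAddOrder
  let _ : Sub M := CanonicallyOrderedAdd.toSub
  have : OrderedSub M := CanonicallyOrderedAdd.toOrderedSub
  exact h M V hM e r

end Arithmetic

/-! ## Pairs, codes of finite sets, and iteration -/

section Substitution

variable {M V : Type} [Add M] [Mul M] [LT M] [Membership M V] {s t u : (ℕ → M) → M}

theorem BoundedDefinable.comp₃ {P : M → M → M → Prop}
    (hP : BoundedDefinable V fun e : ℕ → M => P (e 0) (e 1) (e 2)) (hs : TermDefinable s)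
    (ht : TermDefinable t) (hu : TermDefinable u) :
    BoundedDefinable V fun e => P (s e) (t e) (u e) := by
  refine hP.comp (fun i e => consVar (s e) (consVar (t e) fun _ => u e) i) ?_
  rintro (_ | _ | _)
  exacts [hs, ht, hu]

theorem BoundedDefinable.comp₂ {P : M → M → Prop}
    (hP : BoundedDefinable V fun e : ℕ → M => P (e 0) (e 1)) (hs : TermDefinable s)
    (ht : TermDefinable t) : BoundedDefinable V fun e => P (s e) (t e) :=
  hP.comp₃ (P := fun m n _ => P m n) hs ht ht

theorem BoundedDefinable.comp₁ {P : M → Prop} (hP : BoundedDefinable V fun e : ℕ → M => P (e 0))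
    (hs : TermDefinable s) : BoundedDefinable V fun e => P (s e) :=
  hP.comp₂ (P := fun m _ => P m) hs hs

end Substitution

section OrderedSemiring

variable {M V : Type} [CommSemiring M] [LinearOrder M]

instance [Membership M V] {s t : (ℕ → M) → M} [TermDefinable s] [TermDefinable t] :
    BoundedDefinable V fun e => s e ≤ t e :=
  (inferInstance : BoundedDefinable V fun e => ¬ t e < s e).congr fun _ => not_lt

/-- The pairing function denoted by `pair`. -/
def mpair {M : Type} [Add M] [Mul M] (m n : M) : M := (m + n) * (m + n) + m

instance {M : Type} [Add M] [Mul M] {s t : (ℕ → M) → M} [TermDefinable s] [TermDefinable t] :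
    TermDefinable fun e => mpair (s e) (t e) :=
  inferInstanceAs (TermDefinable fun e => (s e + t e) * (s e + t e) + s e)

variable [IsStrictOrderedRing M] [CanonicallyOrderedAdd M]

omit [IsStrictOrderedRing M] in
theorem left_le_mpair (m n : M) : m ≤ mpair m n := le_add_self

variable [SuccAddOrder M]

theorem right_le_mpair (m n : M) : n ≤ mpair m n := by
  rcases eq_zero_or_pos n with rfl | hn
  · exact zero_le
  calc n ≤ m + n := le_add_self
    _ ≤ (m + n) * (m + n) :=
      le_mul_of_one_le_left zero_le (Order.one_le_iff_pos.2 (hn.trans_le le_add_self))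
    _ ≤ mpair m n := le_self_add

theorem add_le_add_of_mpair_eq {m n k l : M} (h : mpair m n = mpair k l) : m + n ≤ k + l := by
  by_contra! hlt
  have h1 := Order.add_one_le_iff.2 hlt
  have h2 : mpair k l < mpair k l :=
    calc mpair k l < mpair k l + (k + l + l + 1) := lt_add_of_pos_right _ (by positivity)
      _ = (k + l + 1) * (k + l + 1) := by unfold mpair; ring
      _ ≤ (m + n) * (m + n) := mul_le_mul' h1 h1
      _ ≤ mpair m n := le_self_add
      _ = mpair k l := h
  exact h2.false

theorem mpair_inj {m n k l : M} : mpair m n = mpair k l ↔ m = k ∧ n = l := by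
  refine ⟨fun h => ?_, fun ⟨hm, hn⟩ => by rw [hm, hn]⟩
  have hsum : m + n = k + l :=
    le_antisymm (add_le_add_of_mpair_eq h) (add_le_add_of_mpair_eq h.symm)
  obtain rfl : m = k := by
    rw [mpair, mpair, hsum] at h
    exact add_left_cancel h
  exact ⟨rfl, add_left_cancel hsum⟩

/-! ### Codes of finite sets -/

section

variable [Membership M V]

omit [CanonicallyOrderedAdd M] in
theorem BoundedDefinable.ex_of_le {P : (ℕ → M) → M → Prop} {t : (ℕ → M) → M} [TermDefinable t]
    [BoundedDefinable V fun e => P (fun i => e (i + 1)) (e 0)]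
    (h : ∀ e m, P e m → m ≤ t e) : BoundedDefinable V fun e => ∃ m, P e m :=
  (inferInstance : BoundedDefinable V fun e => ∃ m, m < t e + 1 ∧ P e m).congr fun e =>
    exists_congr fun m => and_iff_right_of_imp fun hm => Order.lt_add_one_iff.2 (h e m hm)

instance {s t : (ℕ → M) → M} [hs : TermDefinable s] [ht : TermDefinable t] :
    BoundedDefinable V fun e => s e ∣ t e := by
  refine BoundedDefinable.comp₂ (P := (· ∣ ·)) ?_ hs ht
  refine (inferInstance : BoundedDefinable V fun e : ℕ → M =>
    ∃ q, q < e 1 + 1 ∧ e 1 = e 0 * q).congr fun e => ⟨fun ⟨q, _, h⟩ => ⟨q, h⟩, fun ⟨q, h⟩ => ?_⟩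
  rcases eq_zero_or_pos (e 0) with h0 | h0
  · exact ⟨0, by positivity, by rw [h, h0, zero_mul, zero_mul]⟩
  · refine ⟨q, Order.lt_add_one_iff.2 ?_, h⟩
    exact h ▸ le_mul_of_one_le_left zero_le (Order.one_le_iff_pos.2 h0)

end

/-- The moduli of Gödel's `β` function. -/
def modulus (b u : M) : M := 1 + (u + 1) * b

instance {s t : (ℕ → M) → M} [TermDefinable s] [TermDefinable t] :
    TermDefinable fun e => modulus (s e) (t e) :=
  inferInstanceAs (TermDefinable fun e => 1 + (t e + 1) * s e)

theorem not_modulus_dvd_one {b : M} (hb : 0 < b) (u : M) : ¬ modulus b u ∣ 1 := by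
  rintro ⟨q, hq⟩
  have hq0 : 0 < q := pos_of_ne_zero fun h => by simp [h] at hq
  have : modulus b u ≤ 1 := hq ▸ le_mul_of_one_le_right zero_le (Order.one_le_iff_pos.2 hq0)
  exact this.not_gt (lt_add_of_pos_right _ (by positivity))

section

variable [Sub M] [OrderedSub M]

omit [SuccAddOrder M] in
theorem dvd_of_dvd_add {p m n : M} (h : p ∣ m + n) (hm : p ∣ m) : p ∣ n := by
  obtain ⟨k, hk⟩ := h
  obtain ⟨l, rfl⟩ := hm
  exact ⟨k - l, by rw [mul_tsub, ← hk, add_tsub_cancel_left]⟩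

omit [SuccAddOrder M] in
theorem dvd_of_modulus_dvd_mul_right {b u m : M} (h : modulus b u ∣ m * b) :
    modulus b u ∣ m := by
  have h1 : modulus b u ∣ m * b * (u + 1) + m := ⟨m, by unfold modulus; ring⟩
  exact dvd_of_dvd_add h1 (h.mul_right _)

theorem exists_modulus_dvd_mul_mul {b n u v m : M} (hu : u < n) (hv : v < n) (huv : u ≠ v)
    (h : modulus b u ∣ m * modulus b v) : ∃ d < n, modulus b u ∣ m * (d + 1) * b := by
  rcases lt_or_gt_of_ne huv with hlt | hlt
  · obtain ⟨d, rfl⟩ := exists_add_of_le (Order.add_one_le_iff.2 hlt)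
    refine ⟨d, (le_add_self : d ≤ u + 1 + d).trans_lt hv,
      dvd_of_dvd_add (m := m * modulus b u) ?_ (dvd_mul_left _ _)⟩
    convert h using 1
    unfold modulus; ring
  · obtain ⟨d, rfl⟩ := exists_add_of_le (Order.add_one_le_iff.2 hlt)
    refine ⟨d, (le_add_self : d ≤ v + 1 + d).trans_lt hu,
      dvd_of_dvd_add (m := m * modulus b v) (Dvd.intro_left m ?_) h⟩
    unfold modulus; ring

theorem dvd_of_modulus_dvd_mul_modulus {b n u v m : M} (hb : ∀ d < n, d + 1 ∣ b) (hu : u < n)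
    (hv : v < n) (huv : u ≠ v) (h : modulus b u ∣ m * modulus b v) : modulus b u ∣ m := by
  obtain ⟨d, hd, hdvd⟩ := exists_modulus_dvd_mul_mul hu hv huv h
  have hmb : modulus b u ∣ m * b * b :=
    hdvd.trans (mul_dvd_mul_right (mul_dvd_mul_left m (hb d hd)) b)
  exact dvd_of_modulus_dvd_mul_right (dvd_of_modulus_dvd_mul_right hmb)

end

/-- `u` is an element of the finite set with code `t`, where `(b, (m, n))` codes the set of the
`u < n` whose modulus divides `m`. -/
def MemCode (t u : M) : Prop :=
  ∃ b m n, t = mpair b (mpair m n) ∧ u < n ∧ modulus b u ∣ m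

theorem memCode_mpair {b m n u : M} :
    MemCode (mpair b (mpair m n)) u ↔ u < n ∧ modulus b u ∣ m := by
  constructor
  · rintro ⟨b', m', n', h, h'⟩
    rw [mpair_inj, mpair_inj] at h
    obtain ⟨rfl, rfl, rfl⟩ := h
    exact h'
  · exact fun h => ⟨b, m, n, rfl, h⟩

theorem MemCode.lt {t u : M} (h : MemCode t u) : u < t := by
  obtain ⟨b, m, n, rfl, hu, -⟩ := h
  exact hu.trans_le ((right_le_mpair _ _).trans (right_le_mpair _ _))

theorem MemCode.left_lt {t i v : M} (h : MemCode t (mpair i v)) : i < t :=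
  (left_le_mpair i v).trans_lt h.lt

theorem MemCode.right_lt {t i v : M} (h : MemCode t (mpair i v)) : v < t :=
  (right_le_mpair i v).trans_lt h.lt

instance [Membership M V] {s t : (ℕ → M) → M} [hs : TermDefinable s] [ht : TermDefinable t] :
    BoundedDefinable V fun e => MemCode (s e) (t e) := by
  refine BoundedDefinable.comp₂ (P := MemCode) ?_ hs ht
  have h_pair : BoundedDefinable V fun e : ℕ → M =>
      ∃ m n, e 1 = mpair (e 0) (mpair m n) ∧ e 2 < n ∧ modulus (e 0) (e 2) ∣ m := by
    have : BoundedDefinable V fun e : ℕ → M =>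
        ∃ n, e 2 = mpair (e 1) (mpair (e 0) n) ∧ e 3 < n ∧ modulus (e 1) (e 3) ∣ e 0 :=
      .ex_of_le (t := fun e => e 2) fun e n h =>
        ((right_le_mpair _ _).trans (right_le_mpair _ _)).trans h.1.ge
    exact .ex_of_le (t := fun e => e 1) fun e m ⟨n, h, _⟩ =>
      ((left_le_mpair _ _).trans (right_le_mpair _ _)).trans h.ge
  exact .ex_of_le (t := fun e => e 0) fun e b ⟨m, n, h, _⟩ => (left_le_mpair _ _).trans h.ge

variable [Sub M] [OrderedSub M] [Membership M V] [Nonempty V]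

namespace IsModel

variable (hM : IsModel M V)

include hM

omit [Sub M] [OrderedSub M] in
theorem exists_common_multiple (n : M) : ∃ b : M, 0 < b ∧ ∀ d < n, d + 1 ∣ b := by
  refine hM.sigma_induction (P := fun n b => 0 < b ∧ ∀ d, d < n → d + 1 ∣ b)
    (by infer_instance) ⟨1, one_pos, fun d h => absurd h not_lt_zero⟩ ?_ n
  rintro n ⟨b, hb, h⟩
  refine ⟨b * (n + 1), by positivity, fun d hd => ?_⟩
  rcases (Order.lt_add_one_iff.1 hd).lt_or_eq with hd | rfl
  · exact (h d hd).mul_right _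
  · exact dvd_mul_left _ _

theorem exists_modulus_dvd_iff {P : M → Prop} (hP : BoundedDefinable V fun e : ℕ → M => P (e 0))
    {b n : M} (hb0 : 0 < b) (hb : ∀ d < n, d + 1 ∣ b) :
    ∃ m, ∀ u < n, modulus b u ∣ m ↔ P u := by
  have hP (s : (ℕ → M) → M) [hs : TermDefinable s] : BoundedDefinable V fun e => P (s e) :=
    hP.comp₁ hs
  suffices ∃ m, ∀ u < n, modulus b u ∣ m ↔ u < n ∧ P u from
    this.imp fun m hm u hu => (hm u hu).trans (and_iff_right hu)
  refine hM.sigma_induction (P := fun i m => ∀ u, u < n → (modulus b u ∣ m ↔ u < i ∧ P u))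
    inferInstance ⟨1, fun u _ => ?_⟩ (fun i ⟨m, hm⟩ => ?_) n
  · exact iff_of_false (not_modulus_dvd_one hb0 u) fun h => not_lt_zero h.1
  by_cases hi : i < n ∧ P i
  · refine ⟨m * modulus b i, fun u hu => ?_⟩
    rcases eq_or_ne u i with rfl | hui
    · exact iff_of_true (dvd_mul_left _ _) ⟨lt_add_one u, hi.2⟩
    · rw [Order.lt_add_one_iff, le_iff_lt_or_eq, or_iff_left hui, ← hm u hu]
      exact ⟨dvd_of_modulus_dvd_mul_modulus hb hu hi.1 hui, fun h => h.mul_right _⟩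
  · refine ⟨m, fun u hu => ?_⟩
    rw [hm u hu, Order.lt_add_one_iff, le_iff_lt_or_eq]
    refine and_congr_left fun hPu => (or_iff_left ?_).symm
    rintro rfl
    exact hi ⟨hu, hPu⟩

theorem exists_code {P : M → Prop} (hP : BoundedDefinable V fun e : ℕ → M => P (e 0)) (n : M) :
    ∃ t, ∀ u, MemCode t u ↔ u < n ∧ P u := by
  obtain ⟨b, hb0, hb⟩ := hM.exists_common_multiple n
  obtain ⟨m, hm⟩ := hM.exists_modulus_dvd_iff hP hb0 hb
  exact ⟨mpair b (mpair m n), fun u => memCode_mpair.trans (and_congr_right (hm u))⟩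

omit [Sub M] [OrderedSub M] in
theorem exists_least {P : M → Prop} (hP : BoundedDefinable V fun e : ℕ → M => P (e 0))
    (h : ∃ n, P n) : ∃ n, P n ∧ ∀ m < n, ¬ P m := by
  by_contra! hne
  have hP (s : (ℕ → M) → M) [hs : TermDefinable s] : BoundedDefinable V fun e => P (s e) :=
    hP.comp₁ hs
  obtain ⟨n, hn⟩ := h
  refine hM.induction (P := fun n => ∀ m, m < n + 1 → ¬ P m) inferInstance ?_ ?_ n n
    (lt_add_one n) hn
  · rintro m hm h
    obtain ⟨l, hl, -⟩ := hne m h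
    exact not_lt_zero (hl.trans_le (Order.lt_add_one_iff.1 hm))
  · intro n ih m hm h
    obtain ⟨l, hl, hPl⟩ := hne m h
    exact ih l (hl.trans_le (Order.lt_add_one_iff.1 hm)) hPl

end IsModel

/-! ### Graphs of functions -/

/-- `F` is the graph of the function `f` on `D`, where `p i` is the code of the argument `i`.
Several indices may have the same code, as with the infinite sequences that stand for the tuple
of their first members. -/
structure IsGraphOn {I : Type} (F : V) (p : I → M) (D : Set I) (f : I → M) : Prop where
  mem_iff_exists : ∀ z, z ∈ F ↔ ∃ i ∈ D, z = mpair (p i) (f i)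
  eq_of_eq : ∀ i ∈ D, ∀ j ∈ D, p i = p j → f i = f j

/-- `F` is the graph of the function `f` on all numbers. -/
abbrev IsGraph (F : V) (f : M → M) : Prop := IsGraphOn F id Set.univ f

section

omit [Sub M] [OrderedSub M] [Nonempty V]

theorem IsGraphOn.mem_iff {I : Type} {F : V} {p : I → M} {D : Set I} {f : I → M}
    (h : IsGraphOn F p D f) {i : I} (hi : i ∈ D) (v : M) : mpair (p i) v ∈ F ↔ f i = v := by
  rw [h.mem_iff_exists]
  constructor
  · rintro ⟨j, hj, hz⟩
    obtain ⟨hp, rfl⟩ := mpair_inj.1 hz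
    exact h.eq_of_eq i hi j hj hp
  · rintro rfl
    exact ⟨i, hi, rfl⟩

theorem IsGraph.mem_iff {F : V} {f : M → M} (h : IsGraph F f) {n v : M} :
    mpair n v ∈ F ↔ f n = v :=
  IsGraphOn.mem_iff h (Set.mem_univ n) v

theorem IsGraph.boundedDefinable {F : V} {f : M → M} (h : IsGraph F f) {s t : (ℕ → M) → M}
    [TermDefinable s] [TermDefinable t] : BoundedDefinable V fun e => f (s e) = t e :=
  (inferInstance : BoundedDefinable V fun e => mpair (s e) (t e) ∈ F).congr fun _ => h.mem_iff

end

namespace IsModel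

variable (hM : IsModel M V)

include hM

section

omit [Sub M] [OrderedSub M]

theorem exists_isGraphOn {I : Type} {p : I → M} {D : Set I} {f : I → M} {R : M → M → M → Prop}
    (hD : BoundedDefinable V fun e : ℕ → M => e 0 ∈ p '' D)
    (hR : BoundedDefinable V fun e : ℕ → M => R (e 0) (e 1) (e 2))
    (h : ∀ i ∈ D, ∀ v, f i = v ↔ ∃ t, R (p i) v t) : ∃ F : V, IsGraphOn F p D f := by
  have hD (s : (ℕ → M) → M) [hs : TermDefinable s] :
      BoundedDefinable V fun e => s e ∈ p '' D := hD.comp₁ hs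
  have hR (s t u : (ℕ → M) → M) [hs : TermDefinable s] [ht : TermDefinable t]
      [hu : TermDefinable u] : BoundedDefinable V fun e => R (s e) (t e) (u e) :=
    hR.comp₃ hs ht hu
  have h_unique {i v w t} (hi : i ∈ D) (hv : f i = v) (hw : R (p i) w t) : w = v :=
    ((h i hi w).2 ⟨t, hw⟩).symm.trans hv
  obtain ⟨F, hF⟩ := hM.comprehension
    (P := fun z t => ∃ n, n < z + 1 ∧ ∃ v, v < z + 1 ∧ z = mpair n v ∧ n ∈ p '' D ∧ R n v t)
    (Q := fun z b => ∃ n, n < z + 1 ∧ ∃ v, v < z + 1 ∧ z = mpair n v ∧ n ∈ p '' D ∧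
      ∀ w, w < b → ∀ t, t < b → R n w t → w = v) inferInstance inferInstance fun z => by
    constructor
    · rintro ⟨t, n, hn, v, hv, rfl, ⟨i, hi, rfl⟩, hRt⟩ b
      exact ⟨_, hn, v, hv, rfl, ⟨i, hi, rfl⟩,
        fun w _ t' _ hw => h_unique hi ((h i hi v).2 ⟨t, hRt⟩) hw⟩
    · intro hz
      obtain ⟨_, hn, v, hv, rfl, ⟨i, hi, rfl⟩, -⟩ := hz 0
      obtain ⟨t, ht⟩ := (h i hi _).1 rfl
      obtain ⟨_, -, v', -, hz, -, hb⟩ := hz (f i + t + 1)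
      obtain ⟨rfl, rfl⟩ := mpair_inj.1 hz
      rw [hb _ (Order.lt_add_one_iff.2 le_self_add) t (Order.lt_add_one_iff.2 le_add_self) ht] at ht
      exact ⟨t, _, hn, v, hv, rfl, ⟨i, hi, rfl⟩, ht⟩
  refine ⟨F, fun z => ?_, fun i hi j hj hp => ?_⟩
  · rw [hF]
    constructor
    · rintro ⟨t, _, -, v, -, rfl, ⟨i, hi, rfl⟩, hRt⟩
      exact ⟨i, hi, by rw [(h i hi v).2 ⟨t, hRt⟩]⟩
    · rintro ⟨i, hi, rfl⟩
      obtain ⟨t, ht⟩ := (h i hi _).1 rfl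
      exact ⟨t, _, Order.lt_add_one_iff.2 (left_le_mpair _ _), _,
        Order.lt_add_one_iff.2 (right_le_mpair _ _), rfl, ⟨i, hi, rfl⟩, ht⟩
  · rw [h i hi, hp, ← h j hj]

theorem induction_of_isGraph {F : V} {f : M → M} (hF : IsGraph F f) {Q : M → M → Prop}
    (hQ : BoundedDefinable V fun e : ℕ → M => Q (e 0) (e 1)) (h0 : Q 0 (f 0))
    (hs : ∀ n, Q n (f n) → Q (n + 1) (f (n + 1))) (n : M) : Q n (f n) := by
  have h_graph : BoundedDefinable V fun e : ℕ → M => f (e 0) = e 1 := hF.boundedDefinable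
  obtain ⟨v, rfl, hv⟩ := hM.sigma_induction (P := fun n v => f n = v ∧ Q n v) inferInstance
    ⟨_, rfl, h0⟩ (fun n ⟨_, hv, hQv⟩ => ⟨_, rfl, hs n (hv ▸ hQv)⟩) n
  exact hv

end

end IsModel

/-! ### Iteration of functions -/

/-- `t` codes a finite part of the sequence of the iterates of `G` at `m`. -/
def IsRun (G : M → M) (m t : M) : Prop :=
  ∀ i v, MemCode t (mpair i v) →
    i = 0 ∧ v = m ∨ ∃ j w, MemCode t (mpair j w) ∧ i = j + 1 ∧ G w = v

section

omit [Sub M] [OrderedSub M] [Nonempty V]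

theorem IsRun.boundedDefinable {G : M → M} (hG : BoundedDefinable V fun e : ℕ → M => G (e 0) = e 1)
    (m : M) {s : (ℕ → M) → M} [hs : TermDefinable s] :
    BoundedDefinable V fun e => IsRun G m (s e) := by
  have hG (s t : (ℕ → M) → M) [hs : TermDefinable s] [ht : TermDefinable t] :
      BoundedDefinable V fun e => G (s e) = t e := hG.comp₂ (P := fun v w => G v = w) hs ht
  refine BoundedDefinable.comp₁ (P := IsRun G m) ?_ hs
  refine (inferInstance : BoundedDefinable V fun e : ℕ → M =>
    ∀ i, i < e 0 → ∀ v, v < e 0 → MemCode (e 0) (mpair i v) → i = 0 ∧ v = m ∨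
      ∃ j, j < e 0 ∧ ∃ w, w < e 0 ∧ MemCode (e 0) (mpair j w) ∧ i = j + 1 ∧ G w = v).congr
    fun e => ?_
  constructor
  · intro h i v hv
    exact (h i hv.left_lt v hv.right_lt hv).imp_right fun ⟨j, _, w, _, h⟩ => ⟨j, w, h⟩
  · intro h i _ v _ hv
    exact (h i v hv).imp_right fun ⟨j, w, h⟩ => ⟨j, h.1.left_lt, w, h.1.right_lt, h⟩

end

namespace IsRun

variable {G : M → M} {m t t' n v w : M}

omit [Sub M] [OrderedSub M]

omit [SuccAddOrder M] in
theorem eq_of_memCode_zero (h : IsRun G m t) (hv : MemCode t (mpair 0 v)) : v = m := by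
  obtain ⟨-, hv⟩ | ⟨j, w, -, h0, -⟩ := h 0 v hv
  · exact hv
  · exact absurd h0.symm (by positivity : 0 < j + 1).ne'

omit [SuccAddOrder M] in
theorem exists_memCode_add_one (h : IsRun G m t) (hv : MemCode t (mpair (n + 1) v)) :
    ∃ w, MemCode t (mpair n w) ∧ G w = v := by
  obtain ⟨h0, -⟩ | ⟨j, w, hw, hj, hG⟩ := h _ v hv
  · exact absurd h0 (by positivity : 0 < n + 1).ne'
  · obtain rfl := add_right_cancel hj
    exact ⟨w, hw, hG⟩

theorem eq_of_memCode (hM : IsModel M V) (h : IsRun G m t) (h' : IsRun G m t')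
    (hv : MemCode t (mpair n v)) (hw : MemCode t' (mpair n w)) : v = w := by
  refine hM.induction (P := fun n => ∀ v, v < t → ∀ w, w < t' → MemCode t (mpair n v) →
    MemCode t' (mpair n w) → v = w) inferInstance ?_ ?_ n v hv.right_lt w hw.right_lt hv hw
  · intro v _ w _ hv hw
    rw [h.eq_of_memCode_zero hv, h'.eq_of_memCode_zero hw]
  · intro n ih v _ w _ hv hw
    obtain ⟨v', hv', rfl⟩ := h.exists_memCode_add_one hv
    obtain ⟨w', hw', rfl⟩ := h'.exists_memCode_add_one hw
    rw [ih v' hv'.right_lt w' hw'.right_lt hv' hw']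

end IsRun

namespace IsModel

variable (hM : IsModel M V) {G : M → M}

include hM

theorem exists_code_insert (t u : M) : ∃ t', ∀ z, MemCode t' z ↔ MemCode t z ∨ z = u := by
  obtain ⟨t', ht'⟩ := hM.exists_code (P := fun z => MemCode t z ∨ z = u) inferInstance (t + u + 1)
  refine ⟨t', fun z => (ht' z).trans (and_iff_right_of_imp ?_)⟩
  rintro (h | rfl)
  · exact h.lt.trans (Order.lt_add_one_iff.2 le_self_add)
  · exact Order.lt_add_one_iff.2 le_add_self

theorem exists_isRun (hG : BoundedDefinable V fun e : ℕ → M => G (e 0) = e 1) (m n : M) :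
    ∃ t, IsRun G m t ∧ ∃ v, v < t ∧ MemCode t (mpair n v) := by
  have h_run {s : (ℕ → M) → M} [TermDefinable s] : BoundedDefinable V fun e => IsRun G m (s e) :=
    IsRun.boundedDefinable hG m
  refine hM.sigma_induction (P := fun n t => IsRun G m t ∧ ∃ v, v < t ∧ MemCode t (mpair n v))
    inferInstance ?_ ?_ n
  · obtain ⟨t, ht⟩ := hM.exists_code (P := fun z => z = mpair 0 m) inferInstance (mpair 0 m + 1)
    have h0 : MemCode t (mpair 0 m) := (ht _).2 ⟨lt_add_one _, rfl⟩
    exact ⟨t, fun i v hv => .inl (mpair_inj.1 ((ht _).1 hv).2), m, h0.right_lt, h0⟩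
  · rintro n ⟨t, ht, v, -, hv⟩
    obtain ⟨t', ht'⟩ := hM.exists_code_insert t (mpair (n + 1) (G v))
    have h_new : MemCode t' (mpair (n + 1) (G v)) := (ht' _).2 (.inr rfl)
    refine ⟨t', fun i w hw => ?_, G v, h_new.right_lt, h_new⟩
    obtain hw | hw := (ht' _).1 hw
    · exact (ht i w hw).imp_right fun ⟨j, l, hl, h⟩ => ⟨j, l, (ht' _).2 (.inl hl), h⟩
    · obtain ⟨rfl, rfl⟩ := mpair_inj.1 hw
      exact .inr ⟨n, v, (ht' _).2 (.inl hv), rfl, rfl⟩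

theorem exists_iterate (hG : BoundedDefinable V fun e : ℕ → M => G (e 0) = e 1) (m : M) :
    ∃ (F : V) (f : M → M), IsGraph F f ∧ f 0 = m ∧ ∀ n, f (n + 1) = G (f n) := by
  choose t ht f _ hf using hM.exists_isRun hG m
  have eq_of_run {t' n v} (h : IsRun G m t') (hv : MemCode t' (mpair n v)) : f n = v :=
    (ht n).eq_of_memCode hM h (hf n) hv
  have h_run {s : (ℕ → M) → M} [TermDefinable s] : BoundedDefinable V fun e => IsRun G m (s e) :=
    IsRun.boundedDefinable hG m
  obtain ⟨F, hF⟩ := hM.exists_isGraphOn (p := id) (D := Set.univ) (f := f)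
    (R := fun n v t => IsRun G m t ∧ MemCode t (mpair n v))
    ((BoundedDefinable.const True).congr fun e => by simp) inferInstance fun n _ v =>
      ⟨fun h => ⟨t n, ht n, h ▸ hf n⟩, fun ⟨t', ht', hv⟩ => eq_of_run ht' hv⟩
  refine ⟨F, f, hF, (ht 0).eq_of_memCode_zero (hf 0), fun n => ?_⟩
  obtain ⟨w, hw, hG⟩ := (ht (n + 1)).exists_memCode_add_one (hf (n + 1))
  rw [← hG, eq_of_run (ht _) hw]

end IsModel

end OrderedSemiring

/-! ## The meaning of the formulas -/

section Names

/-- The environment `e`, except that the names `ν 0, …, ν (n - 1)` have the values `f`. -/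
noncomputable def setNames {M : Type} (ν : ℕ → ℕ) (n : ℕ) (f e : ℕ → M) : ℕ → M :=
  Function.extend ν (fun i => if i < n then f i else e (ν i)) e

variable {M : Type} {ν : ℕ → ℕ} {n i : ℕ} (e f : ℕ → M)

theorem setNames_apply (hν : ν.Injective) (hi : i < n) : setNames ν n f e (ν i) = f i := by
  rw [setNames, hν.extend_apply, if_pos hi]

theorem setNames_of_forall_ne (h : ∀ l, ν l ≠ i) : setNames ν n f e i = e i :=
  Function.extend_apply' _ _ _ fun ⟨l, hl⟩ => h l hl

theorem setNames_eq_ite (hν : ν.Injective) (v : ℕ → M) :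
    setNames ν n (fun i => v (ν i)) e =
      fun i => if i ∈ (List.range n).map ν then v i else e i := by
  funext i
  by_cases h : ∃ l, ν l = i
  · obtain ⟨l, rfl⟩ := h
    simp [setNames, hν.extend_apply, hν.eq_iff]
  · rw [setNames_of_forall_ne _ _ (not_exists.1 h), if_neg]
    exact fun hi => h ((List.mem_map.1 hi).imp fun _ => And.right)

theorem x_injective : x.Injective := fun i l (h : 10 + 2 * i = 10 + 2 * l) => by omega

theorem y_injective : y.Injective := fun i l (h : 11 + 2 * i = 11 + 2 * l) => by omega

theorem names_lt : c < 10 ∧ j < 10 ∧ j' < 10 ∧ z < 10 := by decide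

theorem setNames_x_of_lt (hi : i < 10) : setNames x n f e i = e i :=
  setNames_of_forall_ne e f fun l (hl : 10 + 2 * l = i) => by omega

theorem setNames_y_of_lt (hi : i < 10) : setNames y n f e i = e i :=
  setNames_of_forall_ne e f fun l (hl : 11 + 2 * l = i) => by omega

theorem setNames_y_x (l : ℕ) : setNames y n f e (x l) = e (x l) :=
  setNames_of_forall_ne e f fun m (hm : 11 + 2 * m = 10 + 2 * l) => by omega

theorem update_x {l : ℕ} (hi : i < 10) (m : M) : Function.update e i m (x l) = e (x l) :=
  Function.update_of_ne (show 10 + 2 * l ≠ i by omega) _ _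

theorem update_y {l : ℕ} (hi : i < 10) (m : M) : Function.update e i m (y l) = e (y l) :=
  Function.update_of_ne (show 11 + 2 * l ≠ i by omega) _ _

end Names

section NamedVariables

variable {M V : Type} [Zero M] [One M] [Add M] [Mul M] [LT M] [Membership M V]
  (e : ℕ → M) (r : ℕ → V)

theorem sat_All (n : ℕ) (φ : Fm) : (All n φ).Sat e r ↔ ∀ m, φ.Sat (Function.update e n m) r := by
  refine forall_congr' fun m => ?_
  rw [Fm.sat_subst]
  refine iff_of_eq (congrArg (fun f => φ.Sat f r) (funext fun i => ?_))
  by_cases h : i = n <;> simp [h, Tm.eval, consVar]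

theorem sat_Ex (n : ℕ) (φ : Fm) : (Ex n φ).Sat e r ↔ ∃ m, φ.Sat (Function.update e n m) r := by
  simp [Ex, Fm.sat_neg, sat_All]

theorem sat_AllSet (n : ℕ) (φ : Fm) :
    (AllSet n φ).Sat e r ↔ ∀ A, φ.Sat e (Function.update r n A) := by
  refine forall_congr' fun A => ?_
  rw [Fm.sat_subst]
  refine iff_of_eq (congrArg (fun f => φ.Sat e f) (funext fun i => ?_))
  by_cases h : i = n <;> simp [h, consVar]

theorem sat_ExSet (n : ℕ) (φ : Fm) :
    (ExSet n φ).Sat e r ↔ ∃ A, φ.Sat e (Function.update r n A) := by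
  simp [ExSet, Fm.sat_neg, sat_AllSet]

theorem sat_AllList (l : List ℕ) (φ : Fm) :
    (AllList l φ).Sat e r ↔ ∀ v : ℕ → M, φ.Sat (fun i => if i ∈ l then v i else e i) r := by
  induction l generalizing e with
  | nil => simp [AllList]
  | cons n l ih =>
    change (All n (AllList l φ)).Sat e r ↔ _
    simp only [sat_All, ih]
    constructor
    · intro h v
      convert h (v n) v using 2 with i
      by_cases h1 : i ∈ l <;> by_cases h2 : i = n <;> simp [h1, h2]
    · intro h m v
      convert h (fun i => if i ∈ l then v i else m) using 2 with i
      by_cases h1 : i ∈ l <;> by_cases h2 : i = n <;> simp [h1, h2]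

theorem sat_ExList (l : List ℕ) (φ : Fm) :
    (ExList l φ).Sat e r ↔ ¬ (AllList l φ.neg).Sat e r := by
  induction l generalizing e with
  | nil => simp [ExList, AllList, Fm.sat_neg]
  | cons n l ih =>
    change (Ex n (ExList l φ)).Sat e r ↔ ¬ (All n (AllList l φ.neg)).Sat e r
    simp [sat_Ex, sat_All, ih]

theorem sat_conj (l : List Fm) : (conj l).Sat e r ↔ ∀ φ ∈ l, φ.Sat e r := by
  induction l with
  | nil => simp [conj, Fm.sat_tru]
  | cons φ l ih =>
    change (φ ⋏ conj l).Sat e r ↔ _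
    simp [Fm.sat_and, ih]

theorem sat_increasing (l : List ℕ) :
    (increasing l).Sat e r ↔ (l.map e).IsChain (· < ·) := by
  induction l with
  | nil => simp [increasing, Fm.sat_tru]
  | cons n l ih =>
    cases l with
    | nil => simp [increasing, Fm.sat_tru]
    | cons m l => simp [increasing, Fm.sat_and, ih, Fm.Sat, Tm.eval]

theorem sat_app (F : ℕ) (l : List Tm) (t : Tm) :
    (app F l t).Sat e r ↔ (pair (tuple l) t).eval e ∈ r F := Iff.rfl

theorem sat_AllList_range {ν : ℕ → ℕ} (hν : ν.Injective) (n : ℕ) (φ : Fm) :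
    (AllList ((List.range n).map ν) φ).Sat e r ↔ ∀ f : ℕ → M, φ.Sat (setNames ν n f e) r := by
  rw [sat_AllList]
  refine ⟨fun h f => ?_, fun h v => ?_⟩
  · obtain ⟨g, hg⟩ := hν.surjective_comp_right f
    have := h g
    rw [← setNames_eq_ite e hν] at this
    exact hg ▸ this
  · rw [← setNames_eq_ite e hν]
    exact h _

theorem sat_ExList_range {ν : ℕ → ℕ} (hν : ν.Injective) (n : ℕ) (φ : Fm) :
    (ExList ((List.range n).map ν) φ).Sat e r ↔ ∃ f : ℕ → M, φ.Sat (setNames ν n f e) r := by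
  simp [sat_ExList, sat_AllList_range e r hν, Fm.sat_neg]

end NamedVariables

section Tuples

variable {M V : Type} [Add M] [Mul M] [Zero M]

/-- The number denoted by `tuple`, for the values of its terms. -/
def mtuple : List M → M
  | [] => 0
  | [m] => m
  | m :: n :: l => mpair m (mtuple (n :: l))

/-- The code of the tuple of the first `n` members of a sequence. -/
def tup (n : ℕ) (f : ℕ → M) : M := mtuple ((List.range n).map f)

theorem tup_congr {n : ℕ} {f g : ℕ → M} (h : ∀ i < n, f i = g i) : tup n f = tup n g :=
  congrArg mtuple (List.map_congr_left fun i hi => h i (List.mem_range.1 hi))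

theorem tup_setNames (n : ℕ) (e f : ℕ → M) {ν : ℕ → ℕ} (hν : ν.Injective) :
    (tup n fun i => setNames ν n f e (ν i)) = tup n f :=
  tup_congr fun _ hi => setNames_apply e f hν hi

theorem eval_pair [One M] (s t : Tm) (e : ℕ → M) :
    (pair s t).eval e = mpair (s.eval e) (t.eval e) := rfl

theorem eval_tuple [One M] (l : List Tm) (e : ℕ → M) :
    (tuple l).eval e = mtuple (l.map (Tm.eval e)) := by
  induction l with
  | nil => rfl
  | cons s l ih =>
    cases l with
    | nil => rfl
    | cons t l =>
      rw [tuple, eval_pair, ih]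
      rfl

theorem eval_tuple_range [One M] (n : ℕ) (t : ℕ → Tm) (e : ℕ → M) :
    (tuple ((List.range n).map t)).eval e = tup n fun i => (t i).eval e := by
  rw [eval_tuple, List.map_map]
  rfl

end Tuples

section Meaning

variable {M V : Type} [CommSemiring M] [LinearOrder M] [Membership M V]

/-- The sequences whose first `n` members are strictly increasing. Their codes represent the
`n`-element subsets. -/
def increasingTuples (M : Type) [LinearOrder M] (n : ℕ) : Set (ℕ → M) :=
  {f | StrictMonoOn f (Set.Iio n)}

section

omit [CommSemiring M]

theorem isChain_map_range_iff (n : ℕ) (f : ℕ → M) :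
    ((List.range n).map f).IsChain (· < ·) ↔ f ∈ increasingTuples M n := by
  rw [List.isChain_iff_pairwise, List.pairwise_iff_getElem]
  simp only [List.length_map, List.length_range, List.getElem_map, List.getElem_range]
  exact ⟨fun h i hi j hj hij => h i j hi hj hij, fun h i j hi hj hij => h hi hj hij⟩

theorem mem_increasingTuples_congr {n : ℕ} {f g : ℕ → M} (h : ∀ i < n, f i = g i) :
    f ∈ increasingTuples M n ↔ g ∈ increasingTuples M n := by
  rw [← isChain_map_range_iff, ← isChain_map_range_iff,
    List.map_congr_left fun i hi => h i (List.mem_range.1 hi)]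

theorem setNames_mem_increasingTuples (n : ℕ) (e f : ℕ → M) {ν : ℕ → ℕ} (hν : ν.Injective) :
    (fun i => setNames ν n f e (ν i)) ∈ increasingTuples M n ↔ f ∈ increasingTuples M n :=
  mem_increasingTuples_congr fun _ hi => setNames_apply e f hν hi

end

/-- `F` is a function, in the sense of `isFunction`, on the codes `p i` for `i ∈ D`, with values in
`R`. -/
def IsFunctionOn {I : Type} (F : V) (p : I → M) (D : Set I) (R : Set M) : Prop :=
  (∀ z ∈ F, ∃ i ∈ D, ∃ j ∈ R, z = mpair (p i) j) ∧
    ∀ i ∈ D, ∃ j ∈ R, mpair (p i) j ∈ F ∧ ∀ j', mpair (p i) j' ∈ F → j' = j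

theorem isFunctionOn_iff [IsStrictOrderedRing M] [CanonicallyOrderedAdd M] [SuccAddOrder M]
    {I : Type} {F : V} {p : I → M} {D : Set I} {R : Set M} :
    IsFunctionOn F p D R ↔ ∃ f, IsGraphOn F p D f ∧ Set.MapsTo f D R := by
  constructor
  · rintro ⟨hF, h⟩
    choose! f hR hf h_unique using h
    refine ⟨f, ⟨fun z => ⟨fun hz => ?_, ?_⟩, fun i hi j hj hp => ?_⟩, hR⟩
    · obtain ⟨i, hi, v, -, rfl⟩ := hF z hz
      exact ⟨i, hi, by rw [h_unique i hi v hz]⟩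
    · rintro ⟨i, hi, rfl⟩
      exact hf i hi
    · exact h_unique j hj _ (hp ▸ hf i hi)
  · rintro ⟨f, hf, hR⟩
    refine ⟨fun z hz => ?_, fun i hi => ⟨f i, hR hi, (hf.mem_iff hi _).2 rfl,
      fun v hv => ((hf.mem_iff hi v).1 hv).symm⟩⟩
    obtain ⟨i, hi, hz⟩ := (hf.mem_iff_exists z).1 hz
    exact ⟨i, hi, f i, hR hi, hz⟩

variable (e : ℕ → M) (r : ℕ → V)

theorem sat_eq (s t : Tm) : (Fm.eq s t).Sat e r ↔ s.eval e = t.eval e := Iff.rfl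

theorem sat_lt (s t : Tm) : (Fm.lt s t).Sat e r ↔ s.eval e < t.eval e := Iff.rfl

theorem sat_mem (t : Tm) (F : ℕ) : (Fm.mem t F).Sat e r ↔ t.eval e ∈ r F := Iff.rfl

theorem sat_le (s t : Tm) : (le s t).Sat e r ↔ s.eval e ≤ t.eval e := by
  rw [le, Fm.sat_or, sat_lt, sat_eq, le_iff_lt_or_eq]

theorem sat_increasing_range (n : ℕ) (ν : ℕ → ℕ) :
    (increasing ((List.range n).map ν)).Sat e r ↔ (fun i => e (ν i)) ∈ increasingTuples M n := by
  rw [sat_increasing, List.map_map, isChain_map_range_iff]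
  rfl

theorem sat_isColouringOfSubsets (n : ℕ) :
    (isColouringOfSubsets n).Sat e r ↔
      IsFunctionOn (r C) (tup n) (increasingTuples M n) (Set.Iio (e k)) := by
  simp [isColouringOfSubsets, isFunction, IsFunctionOn, xs, sat_All, sat_Ex, sat_app,
    Fm.sat_imp, Fm.sat_and, sat_eq, sat_lt, sat_mem, sat_AllList_range, sat_ExList_range,
    sat_increasing_range, setNames_mem_increasingTuples, tup_setNames, eval_pair, eval_tuple_range,
    x_injective, setNames_x_of_lt, update_x, names_lt, Tm.eval]

theorem sat_isColouringOfTuples (n : ℕ) :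
    (isColouringOfTuples n).Sat e r ↔
      IsFunctionOn (r C) (tup (M := M) n) Set.univ (Set.Iio (e k)) := by
  simp [isColouringOfTuples, isFunction, IsFunctionOn, ys, sat_All, sat_Ex, sat_app, Fm.sat_tru,
    Fm.sat_imp, Fm.sat_and, sat_eq, sat_lt, sat_mem, sat_AllList_range, sat_ExList_range,
    tup_setNames, eval_pair, eval_tuple_range, y_injective, setNames_y_of_lt, update_y, names_lt,
    Tm.eval]

theorem sat_infinite (F : ℕ) : (infinite F).Sat e r ↔ ∀ m : M, ∃ n ∈ r F, m < n := by
  simp [infinite, sat_All, sat_Ex, Fm.sat_and, sat_lt, sat_mem, Tm.eval, and_comm]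

section

variable [IsStrictOrderedRing M] [CanonicallyOrderedAdd M] [SuccAddOrder M]

variable (M V) in
/-- The meaning of `ZRT n` in a structure with numbers `M` and sets `V`; an `n`-element subset is
encoded by the sequences in `increasingTuples M n` that enumerate it. -/
def ZRTHolds (n : ℕ) : Prop :=
  ∀ (C : V) (k : M) (c : (ℕ → M) → M), IsGraphOn C (tup n) (increasingTuples M n) c →
    (∀ f ∈ increasingTuples M n, c f < k) →
    (∀ f ∈ increasingTuples M n, ∀ z, c (fun i => f i + z) = c f) →
    ∃ X : V, (∀ m : M, ∃ n ∈ X, m < n) ∧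
      ∃ j : M, ∀ f ∈ increasingTuples M n, (∀ i < n, f i ∈ X) → c f = j

theorem sat_isInvariant {e : ℕ → M} {r : ℕ → V} {n : ℕ} {c : (ℕ → M) → M}
    (hc : IsGraphOn (r C) (tup n) (increasingTuples M n) c) :
    (isInvariant n).Sat e r ↔
      ∀ f ∈ increasingTuples M n, ∀ z, c (fun i => f i + z) = c f := by
  have h_add {f : ℕ → M} (hf : f ∈ increasingTuples M n) (z : M) :
      (fun i => f i + z) ∈ increasingTuples M n := fun _ hi _ hj hij =>
    add_lt_add_left (hf hi hj hij) z
  have h_sat : (isInvariant n).Sat e r ↔ ∀ f z j, f ∈ increasingTuples M n →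
      (mpair (tup n f) j ∈ r C ↔ mpair (tup n fun i => f i + z) j ∈ r C) := by
    have h_tup (f e : ℕ → M) (z : M) :
        (tup n fun i => setNames x n f e (x i) + z) = tup n fun i => f i + z :=
      tup_congr fun i hi => by rw [setNames_apply e f x_injective hi]
    simp [isInvariant, xs, sat_All, Fm.sat_imp, Fm.sat_iff, sat_AllList_range,
      sat_increasing_range, sat_app, eval_pair, eval_tuple_range, setNames_mem_increasingTuples,
      tup_setNames, h_tup, x_injective, update_x, names_lt, Tm.eval]
  rw [h_sat]
  constructor
  · intro h f hf z
    rw [← hc.mem_iff (h_add hf z), ← h f z _ hf, hc.mem_iff hf]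
  · intro h f z j hf
    rw [hc.mem_iff hf, hc.mem_iff (h_add hf z), h f hf z]

theorem sat_isHomogeneous {e : ℕ → M} {r : ℕ → V} {n : ℕ} {c : (ℕ → M) → M}
    (hc : IsGraphOn (r C) (tup n) (increasingTuples M n) c) :
    (isHomogeneous n).Sat e r ↔
      ∃ j, ∀ f ∈ increasingTuples M n, (∀ i < n, f i ∈ r X) → c f = j := by
  have h_mem (f e : ℕ → M) :
      (∀ i < n, setNames x n f e (x i) ∈ r X) ↔ ∀ i < n, f i ∈ r X :=
    forall₂_congr fun i hi => by rw [setNames_apply e f x_injective hi]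
  have h_sat : (isHomogeneous n).Sat e r ↔ ∃ j, ∀ f, f ∈ increasingTuples M n →
      (∀ i < n, f i ∈ r X) → mpair (tup n f) j ∈ r C := by
    simp [isHomogeneous, xs, sat_Ex, Fm.sat_imp, Fm.sat_and, sat_conj, sat_AllList_range,
      sat_increasing_range, sat_app, sat_mem, eval_pair, eval_tuple_range,
      setNames_mem_increasingTuples, tup_setNames, h_mem, x_injective, setNames_x_of_lt, Tm.eval]
  rw [h_sat]
  exact exists_congr fun j => forall₂_congr fun f hf => imp_congr_right fun _ => hc.mem_iff hf j

theorem sat_ZRT (n : ℕ) : (ZRT n).Sat e r ↔ ZRTHolds M V n := by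
  simp only [ZRT, sat_AllSet, sat_All, sat_ExSet, Fm.sat_imp, Fm.sat_and, sat_infinite,
    sat_isColouringOfSubsets, isFunctionOn_iff]
  refine forall₂_congr fun A m => ?_
  rw [and_imp, forall_exists_index]
  refine forall_congr' fun c => ?_
  rw [and_imp]
  refine forall_congr' fun hc => imp_congr_right fun _ => ?_
  rw [sat_isInvariant (by simpa using hc)]
  refine imp_congr_right fun _ => exists_congr fun B => ?_
  rw [sat_isHomogeneous (by simpa using hc)]
  simp

/-- `E` is the graph of the increasing enumeration `y` of `X`. -/
structure IsEnumeration (X E : V) (y : M → M) : Prop where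
  isGraph : IsGraph E y
  strictMono : StrictMono y
  mem_iff : ∀ v, v ∈ X ↔ ∃ n, y n = v

/-- `S` is the graph of the function `s` on the pairs `m ≤ n`. -/
abbrev IsGraphOnLe (S : V) (s : M → M → M) : Prop :=
  IsGraphOn S (fun q => mpair q.1 q.2) {q : M × M | q.1 ≤ q.2} fun q => s q.1 q.2

theorem IsGraphOnLe.mem_iff {S : V} {s : M → M → M} (hs : IsGraphOnLe S s) {m n : M} (hmn : m ≤ n)
    {v : M} : mpair (mpair m n) v ∈ S ↔ s m n = v :=
  IsGraphOn.mem_iff hs (i := (m, n)) (Set.mem_ofPred.2 hmn) v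

/-- `S` is the graph of the function `s` of the sums `s m n = y m + y (m + 1) + ⋯ + y n`. -/
structure IsAdjacentSums (y : M → M) (S : V) (s : M → M → M) : Prop where
  isGraphOnLe : IsGraphOnLe S s
  self : ∀ m, s m m = y m
  add_one : ∀ m n, m ≤ n → s m (n + 1) = s m n + y (n + 1)

/-- The indices at which adjacent sums start, as in `start`. -/
def startAt (f : ℕ → M) : ℕ → M
  | 0 => f 0
  | i + 1 => f (i + 1) + 1

variable (M V) in
/-- The meaning of `AHTd d` in a structure with numbers `M` and sets `V`; the bounds
`k₀ ≤ k₁ < ⋯ < k_d` of the `d` adjacent blocks are the values `f 0, …, f d`. -/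
def AHTdHolds (d : ℕ) : Prop :=
  ∀ (C : V) (k : M) (c : (ℕ → M) → M), IsGraphOn C (tup d) Set.univ c → (∀ f, c f < k) →
    ∃ X : V, (∀ m : M, ∃ n ∈ X, m < n) ∧ ∃ E y, IsEnumeration X E y ∧
      ∃ (S : V) (s : M → M → M), IsAdjacentSums y S s ∧
        ∃ j : M, ∀ f : ℕ → M, f 0 ≤ f 1 → (fun i => f (i + 1)) ∈ increasingTuples M d →
          c (fun i => s (startAt f i) (f (i + 1))) = j

variable (M V) in
/-- The meaning of `AHT` in a structure with numbers `M` and sets `V`. -/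
def AHTHolds : Prop :=
  ∀ (C : V) (k : M) (c : M → M), IsGraph C c → (∀ n, c n < k) →
    ∃ X : V, (∀ m : M, ∃ n ∈ X, m < n) ∧ ∃ E y, IsEnumeration X E y ∧
      ∃ (S : V) (s : M → M → M), IsAdjacentSums y S s ∧ ∃ j : M, ∀ m n, c (s m (m + n)) = j

theorem sat_isEnumeration :
    isEnumeration.Sat e r ↔ ∃ y : M → M, IsEnumeration (r X) (r E) y := by
  have h_sat : isEnumeration.Sat e r ↔ IsFunctionOn (r E) id Set.univ (Set.univ : Set M) ∧
      (∀ m n v w : M, m < n → mpair m v ∈ r E → mpair n w ∈ r E → v < w) ∧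
      ∀ v : M, v ∈ r X ↔ ∃ m, mpair m v ∈ r E := by
    simp [isEnumeration, IsFunctionOn, isFunction, ExList, AllList, sat_All, sat_Ex, Fm.sat_imp,
      Fm.sat_and, Fm.sat_iff, Fm.sat_tru, sat_app, sat_eq, sat_mem, sat_lt, eval_pair, tuple,
      Tm.eval]
  rw [h_sat, isFunctionOn_iff]
  constructor
  · rintro ⟨⟨f, hf : IsGraph _ _, -⟩, h_mono, h_mem⟩
    refine ⟨f, hf, fun m n hmn => h_mono _ _ _ _ hmn (hf.mem_iff.2 rfl) (hf.mem_iff.2 rfl), ?_⟩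
    simpa only [hf.mem_iff] using h_mem
  · rintro ⟨f, hf, h_mono, h_mem⟩
    refine ⟨⟨f, hf, Set.mapsTo_univ _ _⟩, ?_⟩
    simp only [hf.mem_iff]
    exact ⟨fun m n _ _ hmn hv hw => hv ▸ hw ▸ h_mono hmn, h_mem⟩

theorem sat_isAdjacentSums {e : ℕ → M} {r : ℕ → V} {y : M → M} (hy : IsGraph (r E) y) :
    isAdjacentSums.Sat e r ↔ ∃ s, IsAdjacentSums y (r S) s := by
  have h_sat : isAdjacentSums.Sat e r ↔
      IsFunctionOn (r S) (fun q => mpair q.1 q.2) {q : M × M | q.1 ≤ q.2} (Set.univ : Set M) ∧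
      (∀ m v : M, mpair (mpair m m) v ∈ r S ↔ mpair m v ∈ r E) ∧
      ∀ m n v w : M, m ≤ n → mpair (mpair m n) v ∈ r S → mpair (n + 1) w ∈ r E →
        mpair (mpair m (n + 1)) (v + w) ∈ r S := by
    simp [isAdjacentSums, IsFunctionOn, isFunction, ExList, AllList, sat_All, sat_Ex, Fm.sat_imp,
      Fm.sat_and, Fm.sat_iff, Fm.sat_tru, sat_app, sat_eq, sat_mem, sat_le, eval_pair, tuple,
      Tm.eval]
  rw [h_sat, isFunctionOn_iff]
  simp only [hy.mem_iff]
  constructor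
  · rintro ⟨⟨s, hs, -⟩, h_self, h_succ⟩
    have hs : IsGraphOnLe (r S) fun m n => s (m, n) := hs
    refine ⟨_, hs, fun m => ?_, fun m n hmn => ?_⟩
    · rw [← hs.mem_iff le_rfl, h_self]
    · rw [← hs.mem_iff (hmn.trans le_self_add)]
      exact h_succ m n _ _ hmn ((hs.mem_iff hmn).2 rfl) rfl
  · rintro ⟨s, hs, h_self, h_succ⟩
    refine ⟨⟨_, hs, Set.mapsTo_univ _ _⟩, fun m v => ?_, fun m n v w hmn hv hw => ?_⟩
    · rw [hs.mem_iff le_rfl, h_self]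
    · rw [hs.mem_iff (hmn.trans le_self_add), h_succ m n hmn, (hs.mem_iff hmn).1 hv, hw]

omit [IsStrictOrderedRing M] [CanonicallyOrderedAdd M] [SuccAddOrder M] in
theorem sat_isAdjacentTuple {d : ℕ} (hd : 1 ≤ d) (f g : ℕ → M) :
    (isAdjacentTuple d).Sat (setNames y d g (setNames x (d + 1) f e)) r ↔
      f 0 ≤ f 1 ∧ (fun i => f (i + 1)) ∈ increasingTuples M d ∧
        ∀ i < d, mpair (mpair (startAt f i) (f (i + 1))) (g i) ∈ r S := by
  set e' := setNames y d g (setNames x (d + 1) f e)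
  have h_x {i : ℕ} (hi : i ≤ d) : e' (x i) = f i :=
    (setNames_y_x _ _ i).trans (setNames_apply e f x_injective (Order.lt_add_one_iff.2 hi))
  have h_y {i : ℕ} (hi : i < d) : e' (y i) = g i := setNames_apply _ g y_injective hi
  have h_start {i : ℕ} (hi : i < d) : (start i).eval e' = startAt f i := by
    cases i with
    | zero => exact h_x (Nat.zero_le d)
    | succ i => exact congrArg (· + 1) (h_x hi.le)
  have h_tail : (xs (d + 1)).tail = (List.range d).map fun i => x (i + 1) := by
    simp [xs, List.range_succ_eq_map, Function.comp_def]
  rw [isAdjacentTuple, h_tail, Fm.sat_and, Fm.sat_and, sat_le, sat_increasing_range,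
    mem_increasingTuples_congr fun i hi => h_x (Nat.succ_le_of_lt hi), sat_conj,
    List.forall_mem_map]
  simp only [Tm.eval, h_x hd, h_x (Nat.zero_le d), List.mem_range, sat_app, tuple, eval_pair]
  refine and_congr_right fun _ => and_congr_right fun _ => forall₂_congr fun i hi => ?_
  rw [h_start hi, h_x hi, h_y hi]

theorem sat_existsAdjacentSums (φ : Fm) :
    (ExSet X (infinite X ⋏ ExSet E (isEnumeration ⋏ ExSet S (isAdjacentSums ⋏ φ)))).Sat e r ↔
      ∃ A : V, (∀ m : M, ∃ n ∈ A, m < n) ∧ ∃ B y, IsEnumeration A B y ∧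
        ∃ (G : V) (s : M → M → M), IsAdjacentSums y G s ∧
          φ.Sat e (Function.update (Function.update (Function.update r X A) E B) S G) := by
  simp only [sat_ExSet, Fm.sat_and, sat_infinite, sat_isEnumeration]
  refine exists_congr fun A => and_congr (by simp) (exists_congr fun B => ?_)
  rw [← exists_and_right]
  refine exists_congr fun y => ?_
  have h_eq : Function.update (Function.update r X A) E B X = A ∧
      Function.update (Function.update r X A) E B E = B := by simp
  rw [h_eq.1, h_eq.2]
  refine and_congr_right fun hy => exists_congr fun G => ?_
  rw [sat_isAdjacentSums (by simpa using hy.isGraph), ← exists_and_right]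
  simp

omit [CanonicallyOrderedAdd M] in
theorem startAt_le {d i : ℕ} {f : ℕ → M} (h : f 0 ≤ f 1)
    (hf : (fun i => f (i + 1)) ∈ increasingTuples M d) (hi : i < d) : startAt f i ≤ f (i + 1) := by
  cases i with
  | zero => exact h
  | succ i =>
    exact Order.add_one_le_iff.2 (hf (Set.mem_Iio.2 (by lia)) (Set.mem_Iio.2 hi) (lt_add_one i))

theorem sat_isAdjacentHomogeneous {e : ℕ → M} {r : ℕ → V} {d : ℕ} (hd : 1 ≤ d)
    {f : (ℕ → M) → M} {s : M → M → M} (hf : IsGraphOn (r C) (tup d) Set.univ f)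
    (hs : IsGraphOnLe (r S) s) :
    (Ex c (AllList (xs (d + 1)) (AllList (ys d) (isAdjacentTuple d ➝
      app C ((ys d).map .var) (.var c))))).Sat e r ↔
      ∃ j : M, ∀ g : ℕ → M, g 0 ≤ g 1 → (fun i => g (i + 1)) ∈ increasingTuples M d →
        f (fun i => s (startAt g i) (g (i + 1))) = j := by
  have h_app (j : M) (g v : ℕ → M) :
      (app C (((List.range d).map y).map .var) (.var c)).Sat
        (setNames y d v (setNames x (d + 1) g (Function.update e c j))) r ↔ f v = j := by
    simp [sat_app, eval_pair, eval_tuple_range, tup_setNames, y_injective,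
      setNames_x_of_lt, setNames_y_of_lt, hf.mem_iff, Tm.eval]
  simp only [sat_Ex, xs, ys, sat_AllList_range _ _ x_injective, sat_AllList_range _ _ y_injective,
    Fm.sat_imp, sat_isAdjacentTuple _ _ hd, h_app, and_imp]
  refine exists_congr fun j => forall_congr' fun g => ?_
  rw [forall_comm]
  refine imp_congr_right fun h0 => ?_
  rw [forall_comm]
  refine imp_congr_right fun hg => ?_
  have h_mem (v : ℕ → M) : (∀ i < d, mpair (mpair (startAt g i) (g (i + 1))) (v i) ∈ r S) ↔
      ∀ i < d, s (startAt g i) (g (i + 1)) = v i :=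
    forall₂_congr fun i hi => hs.mem_iff (startAt_le h0 hg hi)
  simp only [h_mem]
  refine ⟨fun h => h _ fun i _ => rfl, fun h v hv => ?_⟩
  rw [← h]
  exact hf.eq_of_eq _ trivial _ trivial (tup_congr fun i hi => (hv i hi).symm)

theorem sat_AHTd {d : ℕ} (hd : 1 ≤ d) : (AHTd d).Sat e r ↔ AHTdHolds M V d := by
  simp only [AHTd, sat_AllSet, sat_All, Fm.sat_imp, sat_isColouringOfTuples, isFunctionOn_iff,
    sat_existsAdjacentSums]
  refine forall₂_congr fun A m => ?_
  rw [forall_exists_index]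
  refine forall_congr' fun f => ?_
  rw [and_imp, Function.update_self]
  refine imp_congr_right fun hf => imp_congr (by simp [Set.MapsTo]) ?_
  refine exists_congr fun B => and_congr_right fun _ => exists₂_congr fun F y =>
    and_congr_right fun _ => exists₂_congr fun G s => and_congr_right fun hs => ?_
  exact sat_isAdjacentHomogeneous hd (by simpa using hf) (by simpa using hs.isGraphOnLe)

theorem sat_AHT : AHT.Sat e r ↔ AHTHolds M V := by
  have h_sat (e : ℕ → M) (r : ℕ → V) :
      (isFunction C [u] .tru (.lt (.var j) (.var k))).Sat e r ↔
        ∃ f, IsGraph (r C) f ∧ Set.MapsTo f Set.univ (Set.Iio (e k)) := by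
    rw [← isFunctionOn_iff]
    simp [isFunction, IsFunctionOn, ExList, AllList, sat_All, sat_Ex, Fm.sat_imp,
      Fm.sat_and, Fm.sat_tru, sat_app, sat_eq, sat_mem, sat_lt, eval_pair, tuple, Tm.eval]
  simp only [AHT, sat_AllSet, sat_All, Fm.sat_imp, h_sat, sat_existsAdjacentSums]
  refine forall₂_congr fun A m => ?_
  rw [forall_exists_index]
  refine forall_congr' fun f => ?_
  rw [and_imp, Function.update_self]
  refine imp_congr_right fun hf => imp_congr (by simp [Set.MapsTo]) ?_
  refine exists_congr fun B => and_congr_right fun _ => exists₂_congr fun F y =>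
    and_congr_right fun _ => exists₂_congr fun G s => and_congr_right fun hs => ?_
  have hs := hs.isGraphOnLe
  simp [sat_Ex, sat_All, Fm.sat_imp, sat_app, tuple, eval_pair, Tm.eval, hf.mem_iff,
    hs.mem_iff]

end

end Meaning

/-! ## Comprehension for sets of tuples -/

section Definability

variable {M V : Type} [CommSemiring M] [LinearOrder M] [Membership M V]

instance {n : ℕ} {t : ℕ → (ℕ → M) → M} [h : ∀ i, TermDefinable (t i)] :
    TermDefinable fun e => ∑ i ∈ Finset.range n, t i e := by
  induction n with
  | zero => exact .const 0
  | succ n ih =>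
    simp only [Finset.sum_range_succ]
    infer_instance

instance {n : ℕ} : TermDefinable (tup (M := M) n) := by
  unfold tup
  induction List.range n with
  | nil => exact .const 0
  | cons i l ih =>
    cases l with
    | nil => exact .var i
    | cons j l => exact inferInstanceAs (TermDefinable fun e =>
        mpair (e i) (mtuple ((j :: l).map e)))

instance {n : ℕ} {t : ℕ → (ℕ → M) → M} [h : ∀ i, TermDefinable (t i)] :
    TermDefinable fun e => tup n fun i => t i e :=
  TermDefinable.comp inferInstance t h

instance {n : ℕ} {P : ℕ → (ℕ → M) → Prop} [h : ∀ i, BoundedDefinable V (P i)] :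
    BoundedDefinable V fun e => ∀ i < n, P i e := by
  induction n with
  | zero => exact (BoundedDefinable.const True).congr fun e => by simp
  | succ n ih =>
    simp only [Nat.forall_lt_succ_right]
    infer_instance

instance {n : ℕ} : BoundedDefinable V fun e : ℕ → M => e ∈ increasingTuples M n :=
  (inferInstance : BoundedDefinable V fun e : ℕ → M => ∀ i < n, ∀ j < n, i < j → e i < e j).congr
    fun _ => ⟨fun h _ hi _ hj hij => h _ hi _ hj hij, fun h _ hi _ hj hij => h hi hj hij⟩

omit [LinearOrder M] in
theorem IsGraphOn.dependsOn {n : ℕ} {C : V} {c : (ℕ → M) → M}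
    (hc : IsGraphOn C (tup n) Set.univ c) : DependsOn c (Set.Iio n) :=
  fun _ _ h => hc.eq_of_eq _ trivial _ trivial (tup_congr h)

end Definability

section

variable {M V : Type} [CommSemiring M] [LinearOrder M] [Membership M V]
  [IsStrictOrderedRing M] [CanonicallyOrderedAdd M] [SuccAddOrder M]

theorem le_mtuple {l : List M} {m : M} (h : m ∈ l) : m ≤ mtuple l := by
  induction l with
  | nil => simp at h
  | cons n l ih =>
    cases l with
    | nil => exact (List.mem_singleton.1 h).le
    | cons n' l =>
      obtain rfl | h := List.mem_cons.1 h
      · exact left_le_mpair _ _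
      · exact (ih h).trans (right_le_mpair _ _)

theorem le_tup {n i : ℕ} (f : ℕ → M) (hi : i < n) : f i ≤ tup n f :=
  le_mtuple (List.mem_map_of_mem (List.mem_range.2 hi))

theorem mtuple_inj {l l' : List M} (hl : l.length = l'.length) (h : mtuple l = mtuple l') :
    l = l' := by
  induction l generalizing l' with
  | nil => exact (List.length_eq_zero_iff.1 hl.symm).symm
  | cons m l ih =>
    obtain ⟨m', l', rfl⟩ := List.exists_cons_of_length_eq_add_one hl.symm
    rw [List.length_cons, List.length_cons, add_left_inj] at hl
    cases l with
    | nil =>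
      obtain rfl := List.length_eq_zero_iff.1 hl.symm
      exact congrArg (fun m => [m]) h
    | cons n l =>
      obtain ⟨n', l', rfl⟩ := List.exists_cons_of_length_eq_add_one hl.symm
      obtain ⟨rfl, h_tail⟩ := mpair_inj.1 h
      rw [ih hl h_tail]

theorem tup_inj {n : ℕ} {f g : ℕ → M} (h : tup n f = tup n g) : ∀ i < n, f i = g i := by
  have := mtuple_inj (by simp) h
  simpa using this

omit [IsStrictOrderedRing M] [CanonicallyOrderedAdd M] [SuccAddOrder M] in
theorem BoundedDefinable.update {Q : (ℕ → M) → Prop} (hQ : BoundedDefinable V Q) (i : ℕ) :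
    BoundedDefinable V fun e => Q (Function.update (fun l => e (l + 1)) i (e 0)) :=
  hQ.comp _ fun l => by
    rcases eq_or_ne l i with rfl | hl
    · simpa using TermDefinable.var 0
    · simpa [hl] using TermDefinable.var (l + 1)

omit [CanonicallyOrderedAdd M] in
theorem BoundedDefinable.exists_update {Q : (ℕ → M) → Prop} (hQ : BoundedDefinable V Q) {i N : ℕ}
    (hN : N ≠ i) (h : ∀ e, Q e → e i ≤ e N) :
    BoundedDefinable V fun e => ∃ m, Q (Function.update e i m) :=
  have := hQ.update i
  .ex_of_le (t := fun e => e N) fun e m hm => by simpa [hN] using h _ hm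

omit [CanonicallyOrderedAdd M] in
theorem BoundedDefinable.exists_piecewise {Q : (ℕ → M) → Prop} (hQ : BoundedDefinable V Q)
    {s : Finset ℕ} {N : ℕ} (hN : N ∉ s) (h : ∀ e, Q e → ∀ i ∈ s, e i ≤ e N) :
    BoundedDefinable V fun e => ∃ f, Q (s.piecewise f e) := by
  induction s using Finset.induction_on generalizing Q with
  | empty => exact hQ.congr fun e => by simp
  | insert i s hi ih =>
    rw [Finset.mem_insert, not_or] at hN
    have h_update (f e : ℕ → M) :
        s.piecewise f (Function.update e i (f i)) = (insert i s).piecewise f e := by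
      rw [Finset.piecewise_insert, Finset.update_piecewise_of_notMem _ _ _ hi]
    refine ((ih hQ hN.2 fun e he l hl => h e he l (Finset.mem_insert_of_mem hl)).exists_update
      hN.1 ?_).congr fun e => ⟨fun ⟨m, f, hf⟩ => ⟨Function.update f i m, ?_⟩,
        fun ⟨f, hf⟩ => ⟨f i, f, h_update f e ▸ hf⟩⟩
    · rintro e ⟨f, hf⟩
      simpa [hi, hN.2] using h _ hf i (Finset.mem_insert_self i s)
    · rw [← h_update, Function.update_self]
      have h_congr : s.piecewise (Function.update f i m) (Function.update e i m) =
          s.piecewise f (Function.update e i m) :=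
        s.piecewise_congr (fun l hl => Function.update_of_ne (ne_of_mem_of_not_mem hl hi) _ _)
          fun _ _ => rfl
      rwa [h_congr]

theorem BoundedDefinable.exists_tup {n : ℕ} {Q : (ℕ → M) → M → Prop}
    (hQ : BoundedDefinable V fun e => Q e (e n)) (h : ∀ v, DependsOn (Q · v) (Set.Iio n)) :
    BoundedDefinable V fun e : ℕ → M => ∃ f, tup n f = e 0 ∧ Q f (e 1) := by
  have h_piecewise (f e : ℕ → M) : ∀ i < n, (Finset.range n).piecewise f e i = f i := fun i hi =>
    Finset.piecewise_eq_of_mem _ _ _ (Finset.mem_range.2 hi)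
  have h_exists : BoundedDefinable V fun e => ∃ f, tup n f = e (n + 1) ∧ Q f (e n) := by
    refine (BoundedDefinable.exists_piecewise (Q := fun e => tup n e = e (n + 1) ∧ Q e (e n))
      (s := Finset.range n) (N := n + 1) inferInstance (by simp) fun e he i hi =>
        (le_tup e (Finset.mem_range.1 hi)).trans he.1.le).congr fun e => exists_congr fun f => ?_
    have h_congr (v : M) : Q ((Finset.range n).piecewise f e) v = Q f v :=
      h v (h_piecewise f e)
    rw [tup_congr (h_piecewise f e), h_congr]
    simp
  refine (h_exists.comp (fun i e => if i = n then e 1 else e 0) fun i => ?_).congr fun e => by simp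
  by_cases hi : i = n
  · simpa [hi] using TermDefinable.var 1
  · simpa [hi] using TermDefinable.var 0

theorem IsModel.exists_isGraphOn_tup [Nonempty V] (hM : IsModel M V) {n : ℕ} {D : Set (ℕ → M)}
    {c : (ℕ → M) → M} (hD : BoundedDefinable V fun e => e ∈ D)
    (hc : BoundedDefinable V fun e => c e = e n) (hDn : DependsOn (· ∈ D) (Set.Iio n))
    (hcn : DependsOn c (Set.Iio n)) : ∃ C : V, IsGraphOn C (tup n) D c := by
  have h_dom : BoundedDefinable V fun e : ℕ → M => e 0 ∈ tup n '' D :=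
    (BoundedDefinable.exists_tup (Q := fun f _ => f ∈ D) hD fun _ => hDn).congr fun e =>
      exists_congr fun f => and_comm
  have h_val : BoundedDefinable V fun e : ℕ → M => ∃ f, tup n f = e 0 ∧ c f = e 1 :=
    .exists_tup (Q := fun f v => c f = v) hc fun v f g h => by simp only [hcn h]
  refine hM.exists_isGraphOn (R := fun z v _ => ∃ f, tup n f = z ∧ c f = v) h_dom h_val
    fun f _ v => ⟨fun h => ⟨0, f, rfl, h⟩, fun ⟨_, g, hg, h⟩ => ?_⟩
  rw [← h, hcn (tup_inj hg)]

section

variable [Sub M] [OrderedSub M]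

instance {s t u : (ℕ → M) → M} [TermDefinable s] [TermDefinable t] [TermDefinable u] :
    BoundedDefinable V fun e => s e = t e - u e :=
  (inferInstance : BoundedDefinable V fun e =>
    t e ≤ u e ∧ s e = 0 ∨ s e + u e = t e).congr fun e => by
      constructor
      · rintro (⟨h, h0⟩ | h)
        · rw [h0, tsub_eq_zero_of_le h]
        · exact eq_tsub_of_add_eq h
      · intro h
        rcases le_total (t e) (u e) with hle | hle
        · exact .inl ⟨hle, h.trans (tsub_eq_zero_of_le hle)⟩
        · exact .inr (h ▸ tsub_add_cancel_of_le hle)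

theorem BoundedDefinable.comp_tsub {Q : (ℕ → M) → Prop} (hQ : BoundedDefinable V Q) (n : ℕ) :
    BoundedDefinable V fun e => Q fun i => if i < n then e (i + 1) - e i else e i := by
  induction n generalizing Q with
  | zero => exact hQ.congr fun e => by simp
  | succ n ih =>
    have h_update : BoundedDefinable V fun e =>
        Q (Function.update e n (e (n + 1) - e n)) := by
      have := hQ.update n
      refine (BoundedDefinable.ex_of_le
        (P := fun e m => m = e (n + 1) - e n ∧ Q (Function.update e n m))
        (t := fun e => e (n + 1)) fun e m h => h.1.trans_le tsub_le_self).congr fun e => ?_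
      simp
    refine (ih h_update).congr fun e => iff_of_eq (congrArg Q (funext fun i => ?_))
    rcases lt_trichotomy i n with h | rfl | h
    · simp [h, h.ne, h.trans]
    · simp
    · simp [h.not_gt, h.ne', h.not_ge]

end

end

section

variable {M V : Type} [CommSemiring M] [LinearOrder M] [Membership M V]
  [IsStrictOrderedRing M] [CanonicallyOrderedAdd M] [SuccAddOrder M] [Nonempty V]

/-! ## Enumerations and adjacent sums in a model -/

section Enumerations

variable {n : ℕ} {F S X E : V} {f y : M → M} {s : M → M → M}

namespace IsModel

variable (hM : IsModel M V)

include hM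

theorem exists_isGraph (hf : BoundedDefinable V fun e : ℕ → M => f (e 0) = e 1) :
    ∃ F : V, IsGraph F f :=
  hM.exists_isGraphOn (R := fun n v _ => f n = v)
    ((BoundedDefinable.const True).congr fun e => by simp) hf fun _ _ _ => (exists_const M).symm

theorem strictMono_of_isGraph (hF : IsGraph F f) (h : ∀ n, f n < f (n + 1)) : StrictMono f := by
  intro m n hmn
  refine hM.induction_of_isGraph hF (Q := fun n v => m < n → f m < v) inferInstance
    (fun hm => absurd hm not_lt_zero) (fun n ih hm => ?_) n hmn
  rcases (Order.lt_add_one_iff.1 hm).lt_or_eq with hm | rfl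
  · exact (ih hm).trans (h n)
  · exact h m

theorem le_apply_of_isGraph (hF : IsGraph F f) (hf : StrictMono f) (n : M) : n ≤ f n :=
  hM.induction_of_isGraph hF (Q := fun n v => n ≤ v) inferInstance zero_le
    (fun n ih => Order.add_one_le_iff.2 (ih.trans_lt (hf (lt_add_one n)))) n

theorem exists_isEnumeration (hE : IsGraph E y) (hy : StrictMono y) :
    ∃ X : V, IsEnumeration X E y := by
  obtain ⟨X, hX⟩ := hM.exists_set (V := V) (P := fun v => ∃ n, n < v + 1 ∧ mpair n v ∈ E)
    inferInstance
  refine ⟨X, hE, hy, fun v => ?_⟩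
  rw [hX]
  constructor
  · rintro ⟨n, -, hn⟩
    exact ⟨n, hE.mem_iff.1 hn⟩
  · rintro ⟨n, rfl⟩
    exact ⟨n, Order.lt_add_one_iff.2 (hM.le_apply_of_isGraph hE hy n), hE.mem_iff.2 rfl⟩

theorem exists_mem_gt_of_isEnumeration (hX : IsEnumeration X E y) (m : M) : ∃ n ∈ X, m < n :=
  ⟨y (m + 1), (hX.mem_iff _).2 ⟨_, rfl⟩,
    Order.add_one_le_iff.1 (hM.le_apply_of_isGraph hX.isGraph hX.strictMono (m + 1))⟩

theorem add_of_isAdjacentSums (hs : IsAdjacentSums y S s) {l m : M} (hlm : l ≤ m) (n : M) :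
    s l (m + 1 + n) = s l m + s (m + 1) (m + 1 + n) := by
  have h_mem {i j v : M} (hij : i ≤ j) : mpair (mpair i j) v ∈ S ↔ s i j = v :=
    hs.isGraphOnLe.mem_iff hij
  have hl (n : M) : l ≤ m + 1 + n := hlm.trans (le_self_add.trans le_self_add)
  have h_sum : ∃ v, mpair (mpair (m + 1) (m + 1 + n)) v ∈ S ∧
      mpair (mpair l (m + 1 + n)) (s l m + v) ∈ S := by
    refine hM.sigma_induction (P := fun n v => mpair (mpair (m + 1) (m + 1 + n)) v ∈ S ∧
        mpair (mpair l (m + 1 + n)) (s l m + v) ∈ S) (by infer_instance)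
      ⟨y (m + 1), ?_, ?_⟩ (fun n ⟨v, hv, h⟩ => ⟨v + y (m + 1 + n + 1), ?_⟩) n
    · rw [h_mem le_self_add, add_zero, hs.self]
    · rw [h_mem (hl 0), add_zero, hs.add_one l m hlm]
    · rw [← add_assoc (m + 1) n 1, h_mem (le_self_add.trans le_self_add),
        h_mem ((hl n).trans le_self_add), hs.add_one _ _ le_self_add, hs.add_one _ _ (hl n),
        (h_mem le_self_add).1 hv, (h_mem (hl n)).1 h]
      exact ⟨rfl, add_assoc _ _ _⟩
  obtain ⟨v, hv, h⟩ := h_sum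
  rw [(h_mem (hl n)).1 h, (h_mem le_self_add).1 hv]

theorem add_of_isAdjacentSums_of_lt (hs : IsAdjacentSums y S s) {l m n : M} (hlm : l ≤ m)
    (hmn : m < n) : s l n = s l m + s (m + 1) n := by
  obtain ⟨p, rfl⟩ := exists_add_of_le (Order.add_one_le_iff.2 hmn)
  exact hM.add_of_isAdjacentSums hs hlm p

theorem exists_isEnumeration_of_isAdjacentSums (hs : IsAdjacentSums y S s) (hy : StrictMono y) :
    ∃ X T : V, IsEnumeration X T (s 0) := by
  obtain ⟨T, hT⟩ := hM.exists_isGraph (f := s 0)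
    ((inferInstance : BoundedDefinable V fun e => mpair (mpair 0 (e 0)) (e 1) ∈ S).congr
      fun e => hs.isGraphOnLe.mem_iff zero_le)
  have h_mono : StrictMono (s 0) := hM.strictMono_of_isGraph hT fun n => by
    rw [hs.add_one 0 n zero_le]
    exact lt_add_of_pos_right _ (zero_le.trans_lt (hy (lt_add_one n)))
  obtain ⟨X, hX⟩ := hM.exists_isEnumeration hT h_mono
  exact ⟨X, T, hX⟩

variable [Sub M] [OrderedSub M]

theorem exists_sparse_sequence (hX : ∀ m : M, ∃ n ∈ X, m < n) :
    ∃ (F : V) (f : M → M), IsGraph F f ∧ (∀ n, f n ∈ X) ∧ ∀ n, f n + f n < f (n + 1) := by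
  have h_least (v : M) : ∃ w, (w ∈ X ∧ v + v < w) ∧ ∀ u < w, ¬ (u ∈ X ∧ v + v < u) :=
    hM.exists_least (P := fun w => w ∈ X ∧ v + v < w) inferInstance (hX (v + v))
  choose G hG hG_least using h_least
  have hG_iff (v w : M) :
      (w ∈ X ∧ v + v < w) ∧ (∀ u, u < w → ¬ (u ∈ X ∧ v + v < u)) ↔ G v = w := by
    refine ⟨fun ⟨hw, h⟩ => le_antisymm ?_ ?_, fun h => h ▸ ⟨hG v, hG_least v⟩⟩
    · exact not_lt.1 fun hlt => hG_least v w hlt hw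
    · exact not_lt.1 fun hlt => h _ hlt (hG v)
  obtain ⟨m, hm, -⟩ := hX 0
  obtain ⟨F, f, hF, hf0, hf⟩ := hM.exists_iterate
    (BoundedDefinable.congr inferInstance fun e => hG_iff (e 0) (e 1)) m
  refine ⟨F, f, hF, hM.induction_of_isGraph hF (Q := fun _ v => v ∈ X) inferInstance (hf0 ▸ hm)
    fun n _ => ?_, fun n => ?_⟩
  · exact hf n ▸ (hG _).1
  · exact hf n ▸ (hG _).2

theorem exists_isAdjacentSums_tsub (hF : IsGraph F f) (hf : StrictMono f) :
    ∃ S : V, IsAdjacentSums (fun n => f (n + 1) - f n) S fun m n => f (n + 1) - f m := by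
  have f_le {m n : M} (hmn : m ≤ n) : f m ≤ f (n + 1) := hf.monotone (hmn.trans le_self_add)
  have h_dom : BoundedDefinable V fun e : ℕ → M =>
      e 0 ∈ (fun q : M × M => mpair q.1 q.2) '' {q | q.1 ≤ q.2} :=
    (inferInstance : BoundedDefinable V fun e : ℕ → M =>
      ∃ m, m < e 0 + 1 ∧ ∃ n, n < e 0 + 1 ∧ m ≤ n ∧ mpair m n = e 0).congr fun e => by
        constructor
        · rintro ⟨m, -, n, -, hmn, h⟩
          exact ⟨(m, n), hmn, h⟩
        · rintro ⟨⟨m, n⟩, hmn, h⟩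
          exact ⟨m, Order.lt_add_one_iff.2 (h ▸ left_le_mpair m n), n,
            Order.lt_add_one_iff.2 (h ▸ right_le_mpair m n), hmn, h⟩
  have hF (s t : (ℕ → M) → M) [TermDefinable s] [TermDefinable t] :
      BoundedDefinable V fun e => f (s e) = t e := hF.boundedDefinable
  have h_graph : ∃ S : V, IsGraphOnLe S fun m n => f (n + 1) - f m := by
    refine hM.exists_isGraphOn (R := fun z v t => ∃ m, m < z + 1 ∧ ∃ n, n < z + 1 ∧
      z = mpair m n ∧ f m = t ∧ f (n + 1) = v + t) h_dom inferInstance ?_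
    rintro ⟨m, n⟩ hmn v
    rw [tsub_eq_iff_eq_add_of_le (f_le hmn)]
    constructor
    · exact fun h => ⟨f m, m, Order.lt_add_one_iff.2 (left_le_mpair m n), n,
        Order.lt_add_one_iff.2 (right_le_mpair m n), rfl, rfl, h⟩
    · rintro ⟨_, m', -, n', -, hz, rfl, h⟩
      obtain ⟨rfl, rfl⟩ := mpair_inj.1 hz
      exact h
  obtain ⟨S, hS⟩ := h_graph
  exact ⟨S, hS, fun _ => rfl, fun m n hmn => (add_comm _ _).trans
    (tsub_add_tsub_cancel (hf.monotone le_self_add) (f_le hmn)) |>.symm⟩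

end IsModel

end Enumerations

/-! ## Partial sums and differences -/

section Differences

variable {d : ℕ}

/-- The sums of the initial segments of a sequence. -/
def partialSums {M : Type} [AddCommMonoid M] (g : ℕ → M) (n : ℕ) : M := ∑ l ∈ Finset.range n, g l

omit [CommSemiring M] [IsStrictOrderedRing M] [CanonicallyOrderedAdd M] [SuccAddOrder M] in
theorem mem_increasingTuples_iff {f : ℕ → M} :
    f ∈ increasingTuples M (d + 1) ↔ ∀ i < d, f i < f (i + 1) := by
  refine ⟨fun hf i hi => hf (by simp; lia) (by simpa) (lt_add_one i), fun h => ?_⟩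
  exact strictMonoOn_of_lt_add_one Set.ordConnected_Iio fun i _ _ hi => h i (by simpa using hi)

omit [CanonicallyOrderedAdd M] [SuccAddOrder M] in
theorem partialSums_mem_increasingTuples {g : ℕ → M} (hg : ∀ i < d, 0 < g i) :
    partialSums g ∈ increasingTuples M (d + 1) :=
  mem_increasingTuples_iff.2 fun i hi => by
    rw [partialSums, partialSums, Finset.sum_range_succ]
    exact lt_add_of_pos_right _ (hg i hi)

omit [LinearOrder M] [IsStrictOrderedRing M] [CanonicallyOrderedAdd M] [SuccAddOrder M] in
theorem partialSums_congr {g g' : ℕ → M} (h : ∀ i < d, g i = g' i) :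
    ∀ i < d + 1, partialSums g i = partialSums g' i := fun i hi =>
  Finset.sum_congr rfl fun l hl => h l (by have := Finset.mem_range.1 hl; lia)

omit [LinearOrder M] [IsStrictOrderedRing M] [CanonicallyOrderedAdd M] [SuccAddOrder M] in
theorem partialSums_add_eq {f g : ℕ → M} (h : ∀ i < d, f (i + 1) = f i + g i) :
    ∀ i < d + 1, partialSums g i + f 0 = f i
  | 0, _ => by simp [partialSums]
  | i + 1, hi => by
    rw [h i (by lia), ← partialSums_add_eq h i (by lia), partialSums, Finset.sum_range_succ,
      partialSums, add_right_comm]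

/-- The successive differences of a sequence. -/
def differences {M : Type} [Add M] [Sub M] (f : ℕ → M) (i : ℕ) : M := f (i + 1) - f i

end Differences

end

section

variable {M V : Type} [CommSemiring M] [LinearOrder M] [Membership M V]
  [IsStrictOrderedRing M] [CanonicallyOrderedAdd M] [SuccAddOrder M] [Nonempty V]

/-! ## The equivalence in a model -/

omit [CanonicallyOrderedAdd M] [SuccAddOrder M] [Nonempty V] in
theorem IsGraphOn.apply_partialSums {d : ℕ} {C : V} {c : (ℕ → M) → M}
    (hc : IsGraphOn C (tup (d + 1)) (increasingTuples M (d + 1)) c)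
    (hinv : ∀ f ∈ increasingTuples M (d + 1), ∀ z, c (fun i => f i + z) = c f) {f g : ℕ → M}
    (hf : f ∈ increasingTuples M (d + 1)) (hfg : ∀ i < d, f (i + 1) = f i + g i) :
    c (partialSums g) = c f := by
  have hg : partialSums g ∈ increasingTuples M (d + 1) :=
    partialSums_mem_increasingTuples fun i hi =>
      pos_of_lt_add_right ((mem_increasingTuples_iff.1 hf i hi).trans_eq (hfg i hi))
  have h_add := partialSums_add_eq hfg
  rw [← hinv _ hg (f 0)]
  exact hc.eq_of_eq _ ((mem_increasingTuples_congr h_add).2 hf) _ hf (tup_congr h_add)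

namespace IsModel

variable {d : ℕ} {C : V} {c : (ℕ → M) → M} (hM : IsModel M V)

include hM

open Classical in
theorem exists_isGraphOn_partialSums
    (hc : IsGraphOn C (tup (d + 1)) (increasingTuples M (d + 1)) c) :
    ∃ C' : V, IsGraphOn C' (tup d) Set.univ fun g =>
      if ∀ i < d, 0 < g i then c (partialSums g) else 0 := by
  refine hM.exists_isGraphOn_tup (BoundedDefinable.const True) ?_ (fun _ _ _ => rfl)
    fun f g h => ?_
  · refine (inferInstance : BoundedDefinable V fun e : ℕ → M =>
      (∀ i < d, 0 < e i) ∧ mpair (tup (d + 1) fun i => ∑ l ∈ Finset.range i, e l) (e d) ∈ C ∨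
        ¬ (∀ i < d, 0 < e i) ∧ 0 = e d).congr fun e => ?_
    split_ifs with he
    · rw [or_iff_left fun h => h.1 he, and_iff_right he]
      exact hc.mem_iff (partialSums_mem_increasingTuples he) (e d)
    · simp [he]
  · have h_pos : (∀ i < d, 0 < f i) ↔ ∀ i < d, 0 < g i :=
      forall₂_congr fun i hi => by rw [h i hi]
    split_ifs with hf hg hg
    · exact hc.eq_of_eq _ (partialSums_mem_increasingTuples hf) _
        (partialSums_mem_increasingTuples hg) (tup_congr (partialSums_congr h))
    · exact absurd (h_pos.1 hf) hg
    · exact absurd (h_pos.2 hg) hf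
    · rfl

theorem zrt_of_aht {d : ℕ} (hd : 1 ≤ d) (h : AHTdHolds M V d) : ZRTHolds M V (d + 1) := by
  intro C k c hc hk hinv
  obtain ⟨C', hC'⟩ := hM.exists_isGraphOn_partialSums hc
  have hk0 : 0 < k := zero_le.trans_lt
    (hk (partialSums 1) (partialSums_mem_increasingTuples fun _ _ => zero_lt_one))
  obtain ⟨Y, -, E, y, hE, S, s, hs, j, hj⟩ := h C' k _ hC' fun g => by
    split_ifs with hg
    exacts [hk _ (partialSums_mem_increasingTuples hg), hk0]
  obtain ⟨X, T, hX⟩ := hM.exists_isEnumeration_of_isAdjacentSums hs hE.strictMono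
  refine ⟨X, hM.exists_mem_gt_of_isEnumeration hX, j, fun f hf hfX => ?_⟩
  choose! a ha using fun i hi => (hX.mem_iff _).1 (hfX i hi)
  have a_lt {i : ℕ} (hi : i < d) : a i < a (i + 1) := by
    rw [← hX.strictMono.lt_iff_lt, ha i (by lia), ha (i + 1) (by lia)]
    exact mem_increasingTuples_iff.1 hf i hi
  have a_mem : a ∈ increasingTuples M (d + 1) := mem_increasingTuples_iff.2 fun i hi => a_lt hi
  have f_add {i : ℕ} (hi : i < d) : f (i + 1) = f i + s (a i + 1) (a (i + 1)) := by
    rw [← ha i (by lia), ← ha (i + 1) (by lia)]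
    exact hM.add_of_isAdjacentSums_of_lt hs zero_le (a_lt hi)
  have s_pos {i : ℕ} (hi : i < d) : 0 < s (a i + 1) (a (i + 1)) :=
    pos_of_lt_add_right ((mem_increasingTuples_iff.1 hf i hi).trans_eq (f_add hi))
  obtain ⟨g, hg0, hg⟩ : ∃ g : ℕ → M, g 0 = a 0 + 1 ∧ ∀ i, g (i + 1) = a (i + 1) :=
    ⟨consVar (a 0 + 1) fun i => a (i + 1), rfl, fun _ => rfl⟩
  have h_start (i : ℕ) : startAt g i = a i + 1 := by
    cases i with
    | zero => exact hg0
    | succ i => exact congrArg (· + 1) (hg i)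
  have h_colour := hj g (by rw [hg0, hg]; exact Order.add_one_le_iff.2 (a_lt hd)) (by
    simp only [hg]
    exact fun i hi l hl hil => a_mem (Nat.add_lt_add_right hi 1) (Nat.add_lt_add_right hl 1)
      (Nat.add_lt_add_right hil 1))
  simp only [h_start, hg] at h_colour
  rw [if_pos fun i => s_pos] at h_colour
  exact (hc.apply_partialSums hinv hf fun i => f_add).symm.trans h_colour

variable [Sub M] [OrderedSub M]

theorem exists_isGraphOn_differences (hc : IsGraphOn C (tup d) Set.univ c) :
    ∃ C' : V, IsGraphOn C' (tup (d + 1)) (increasingTuples M (d + 1)) fun f =>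
      c (differences f) := by
  have h_value : BoundedDefinable V fun e : ℕ → M => c e = e (d + 1) :=
    (inferInstance : BoundedDefinable V fun e : ℕ → M => mpair (tup d e) (e (d + 1)) ∈ C).congr
      fun e => hc.mem_iff trivial _
  refine hM.exists_isGraphOn_tup inferInstance ((h_value.comp_tsub d).congr fun e => ?_)
    (fun f g h => propext (mem_increasingTuples_congr h)) fun f g h => hc.dependsOn fun i hi => ?_
  · have h_congr : c (fun i => if i < d then e (i + 1) - e i else e i) = c (differences e) :=
      hc.dependsOn fun i hi => if_pos hi
    simp [h_congr]
  · rw [differences, differences, h i (Nat.lt_add_right 1 hi),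
      h (i + 1) (Nat.add_lt_add_right hi 1)]

theorem aht_of_zrt (d : ℕ) (h : ZRTHolds M V (d + 1)) : AHTdHolds M V d := by
  intro C k c hc hk
  obtain ⟨C', hC'⟩ := hM.exists_isGraphOn_differences hc
  obtain ⟨X, hX, j, hj⟩ := h C' k _ hC' (fun f _ => hk _) fun f _ z =>
    congrArg c (funext fun i => add_tsub_add_eq_tsub_right _ _ _)
  obtain ⟨F, f, hF, hfX, hf⟩ := hM.exists_sparse_sequence hX
  have f_mono : StrictMono f :=
    hM.strictMono_of_isGraph hF fun n => le_self_add.trans_lt (hf n)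
  obtain ⟨S, hS⟩ := hM.exists_isAdjacentSums_tsub hF f_mono
  obtain ⟨E, hE⟩ : ∃ E : V, IsGraph E fun n => f (n + 1) - f n := hM.exists_isGraph
    ((inferInstance : BoundedDefinable V fun e => mpair (mpair (e 0) (e 0)) (e 1) ∈ S).congr
      fun e => hS.isGraphOnLe.mem_iff le_rfl)
  have y_mono : StrictMono fun n => f (n + 1) - f n := hM.strictMono_of_isGraph hE fun n =>
    tsub_le_self.trans_lt (lt_tsub_iff_right.2 (hf (n + 1)))
  obtain ⟨Y, hY⟩ := hM.exists_isEnumeration hE y_mono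
  refine ⟨Y, hM.exists_mem_gt_of_isEnumeration hY, E, _, hY, S, _, hS, j, fun g h0 hg => ?_⟩
  exact hj (fun i => f (startAt g i))
    (mem_increasingTuples_iff.2 fun i hi => f_mono (Order.lt_add_one_iff.2 (startAt_le h0 hg hi)))
    fun i _ => hfX _

end IsModel

omit [IsStrictOrderedRing M] [CanonicallyOrderedAdd M] [SuccAddOrder M] [Nonempty V]

omit [LinearOrder M] in
theorem isGraphOn_tup_one_iff {C : V} {c : M → M} :
    IsGraphOn C (tup 1) Set.univ (fun f => c (f 0)) ↔ IsGraph C c := by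
  have h_iff (z : M) : (∃ f ∈ Set.univ, z = mpair (tup 1 f) (c (f 0))) ↔
      ∃ n ∈ Set.univ, z = mpair (id n) (c n) :=
    ⟨fun ⟨f, _, hz⟩ => ⟨f 0, trivial, hz⟩, fun ⟨n, _, hz⟩ => ⟨fun _ => n, trivial, hz⟩⟩
  exact ⟨fun h => ⟨fun z => (h.mem_iff_exists z).trans (h_iff z), fun _ _ _ _ => congrArg c⟩,
    fun h => ⟨fun z => (h.mem_iff_exists z).trans (h_iff z).symm, fun _ _ _ _ => congrArg c⟩⟩

variable (M V) in
theorem ahtdHolds_one_iff [CanonicallyOrderedAdd M] : AHTdHolds M V 1 ↔ AHTHolds M V := by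
  constructor
  · intro h C k c hc hk
    obtain ⟨X, hX, E, y, hE, S, s, hs, j, hj⟩ :=
      h C k _ (isGraphOn_tup_one_iff.2 hc) fun f => hk (f 0)
    exact ⟨X, hX, E, y, hE, S, s, hs, j, fun m n => hj (consVar m fun _ => m + n) le_self_add
      (mem_increasingTuples_iff.2 fun _ hi => absurd hi (Nat.not_lt_zero _))⟩
  · intro h C k c hc hk
    have h_const (f : ℕ → M) : c f = c fun _ => f 0 :=
      hc.dependsOn fun i hi => congrArg f (Nat.lt_one_iff.1 hi)
    rw [funext h_const, isGraphOn_tup_one_iff (c := fun n => c fun _ => n)] at hc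
    obtain ⟨X, hX, E, y, hE, S, s, hs, j, hj⟩ := h C k _ hc fun n => hk _
    refine ⟨X, hX, E, y, hE, S, s, hs, j, fun f hf _ => ?_⟩
    obtain ⟨n, hn⟩ := exists_add_of_le hf
    rw [h_const, hn]
    exact hj (f 0) n

end

end SOA

theorem corollary3 :
    (∀ d : ℕ, 1 ≤ d → SOA.Proves SOA.RCA0 (SOA.ZRT (d + 1) ⭤ SOA.AHTd d)) ∧
      SOA.Proves SOA.RCA0 (SOA.AHT ⭤ SOA.ZRT 2) := by
  refine ⟨fun d hd => SOA.rca0_proves fun M V _ _ _ _ _ _ _ _ _ hM e r => ?_,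
    SOA.rca0_proves fun M V _ _ _ _ _ _ _ _ _ hM e r => ?_⟩
  · rw [SOA.Fm.sat_iff, SOA.sat_ZRT, SOA.sat_AHTd e r hd]
    exact ⟨hM.aht_of_zrt d, hM.zrt_of_aht hd⟩
  · rw [SOA.Fm.sat_iff, SOA.sat_AHT, SOA.sat_ZRT, ← SOA.ahtdHolds_one_iff]
    exact ⟨hM.zrt_of_aht le_rfl, hM.aht_of_zrt 1⟩
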